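/- Let $2\le c\le d$ and $p\ge 0$ be integers, $b>0$, and let $Y=[0,b]^d\times\{2b\}\times\{e_1,\dots,e_d\}$, where $(z,2b,e_l)$ stands for the facet $\{x\in\mathbb R^d:\ x_l=z_l,\ |x_i-z_i|\le b\ (i\ne l)\}$ with orientation $e_l$. Let $\chi\ge 0$ be a bounded measurable function on $[0,b]^d$ that is not almost everywhere zero, and let $\lambda(\mathrm d(z,r,\phi))=\chi(z)\,\mathrm dz\,\delta_{2b}(\mathrm dr)\,\frac1d\sum_{i=1}^d\delta_{e_i}(\mathrm d\phi)$. For $a>0$ let $\eta_a$ be a Poisson process on $Y$ with intensity measure $a\lambda$, regarded as a random finite subset of $Y$. For a finite set $\mathbf x\subset Y$ put $G_c(\mathbf x)=\frac1{c!}\sum \mathbb H^{d-c}(x_1\cap\dots\cap x_c)\in[0,\infty]$, where the sum is over ordered $c$-tuples of distinct facets of $\mathbf x$ and $\mathbb H^{d-c}$ is the Hausdorff measure. Fix $\nu_c<0$ and let $\mu_a^{(c)}$ be the process whose density with respect to $\eta_a$ is $f(\mathbf x)=c_a\exp(\nu_cG_c(\mathbf x))$, where $\exp(-\infty)=0$ and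 $c_a=1/\mathbb E\exp(\nu_cG_c(\eta_a))$. Its $p$-th correlation function is $$\rho_p(x_1,\dots,x_p;\mu_a^{(c)})=\mathbb E\left[\frac{f(\mu_a^{(c)}\cup\{x_1,\dots,x_p\})}{f(\mu_a^{(c)})}\right].$$ Then there exist $R,S>0$, depending only on $d,c,p,b,\chi,\nu_c$, such that for all $a>0$ and all distinct $x_1,\dots,x_p\in Y$ the following holds, where $k$ is the number of distinct orientations among $x_1,\dots,x_p$: if $k\ge c$, or if no two of the facets $x_1,\dots,x_p$ lie in the same hyperplane, then $\rho_p(x_1,\dots,x_p;\mu_a^{(c)})$ is finite and $$\left|\rho_p(x_1,\dots,x_p;\mu_a^{(c)})-\frac{\binom{d-k}{d-c+1}}{\binom{d}{d-c+1}}\right|<Re^{-Sa}.$$ -/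

import Mathlib

open MeasureTheory ProbabilityTheory
open scoped ENNReal NNReal

noncomputable section

/-- The window `[0,b]^d` of facet centres. -/
abbrev Window (d : ℕ) (b : ℝ) : Type :=
  Set.Icc (0 : Fin d → ℝ) (fun _ => b)

/-- The space `Y = [0,b]^d × {2b} × {e_1, …, e_d}` of facets. The constant size `2b` is not
recorded, and the orientation `e_l` is recorded by its index `l`. -/
abbrev Facet (d : ℕ) (b : ℝ) : Type := Window d b × Fin d

/-- The centre of a facet. -/
def Facet.centre {d : ℕ} {b : ℝ} (y : Facet d b) : Fin d → ℝ := y.1.1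

/-- The index `l` of the normal orientation `e_l` of a facet. -/
def Facet.orientation {d : ℕ} {b : ℝ} (y : Facet d b) : Fin d := y.2

/-- The compact subset of a hyperplane of `ℝ^d` represented by a point of the facet space. -/
def Facet.toSet {d : ℕ} {b : ℝ} (y : Facet d b) : Set (EuclideanSpace ℝ (Fin d)) :=
  {x | x (Facet.orientation y) = Facet.centre y (Facet.orientation y) ∧
    ∀ i, i ≠ Facet.orientation y → |x i - Facet.centre y i| ≤ b}

/-- Two facets lie in the same hyperplane: they have the same orientation `e_l`, and the
`l`-th coordinates of their centres agree. -/
def Facet.SameHyperplane {d : ℕ} {b : ℝ} (y y' : Facet d b) : Prop :=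
  Facet.orientation y = Facet.orientation y' ∧
    Facet.centre y (Facet.orientation y) = Facet.centre y' (Facet.orientation y)

/-- The measure `λ(d(z,r,φ)) = χ(z) dz δ_{2b}(dr) (1/d) ∑ δ_{e_i}(dφ)` on the facet space. -/
def facetMeasure {d : ℕ} {b : ℝ} (χ : Window d b → ℝ≥0) : Measure (Facet d b) :=
  ((Measure.comap Subtype.val (volume : Measure (Fin d → ℝ))).withDensity
      (fun z => (χ z : ℝ≥0∞))).prod
    ((d : ℝ≥0∞)⁻¹ • ∑ i : Fin d, Measure.dirac i)

/-- Finite simple counting measures on `Y`, identified with their supports. -/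
abbrev Configuration (Y : Type*) : Type _ := Finset Y

open Classical in
/-- The number of points of a configuration in a set. -/
def Configuration.count {Y : Type*} (A : Set Y) (x : Configuration Y) : ℕ :=
  (x.filter (fun y => y ∈ A)).card

/-- The smallest σ-algebra making all maps `x ↦ x(A)`, `A` measurable, measurable. -/
instance Configuration.instMeasurableSpace {Y : Type*} [MeasurableSpace Y] :
    MeasurableSpace (Configuration Y) :=
  ⨆ (A : Set Y) (_ : MeasurableSet A), MeasurableSpace.comap (Configuration.count A) ⊤

/-- `η` is a (finite, simple) Poisson process with finite intensity measure `Λ`. -/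
structure IsPoissonProcess {Ω Y : Type*} [MeasurableSpace Ω] [MeasurableSpace Y]
    (P : Measure Ω) (Λ : Measure Y) (η : Ω → Configuration Y) : Prop where
  measurable : Measurable η
  map_count : ∀ A : Set Y, MeasurableSet A →
    P.map (fun ω => Configuration.count A (η ω)) = poissonMeasure (Λ A).toNNReal
  indep : ∀ (n : ℕ) (A : Fin n → Set Y), (∀ i, MeasurableSet (A i)) →
    Pairwise (fun i j => Disjoint (A i) (A j)) →
    iIndepFun (fun i ω => Configuration.count (A i) (η ω)) P

open Classical in
/-- The `U`-statistic `G_j`: the sum over ordered `j`-tuples of distinct facets of `x` of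
`(1/j!) H^{d-j}(x_1 ∩ ⋯ ∩ x_j)`, with values in `[0,∞]`. -/
def facetG {d : ℕ} {b : ℝ} (j : ℕ) (x : Configuration (Facet d b)) : ℝ≥0∞ :=
  ∑ t : Fin j ↪ {y // y ∈ x},
    (j.factorial : ℝ≥0∞)⁻¹ *
      (Measure.euclideanHausdorffMeasure (d - j) : Measure (EuclideanSpace ℝ (Fin d)))
        (⋂ i, Facet.toSet (t i).1)

/-- `exp (ν G_c(x))`, where `exp (-∞) = 0`. -/
def submodelWeight {d : ℕ} {b : ℝ} (c : ℕ) (ν : ℝ) (x : Configuration (Facet d b)) : ℝ≥0∞ :=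
  EReal.exp ((ν : EReal) * ((facetG c x : ℝ≥0∞) : EReal))

/-- The density `c_a exp (ν G_c(x))` of the submodel of order `c`, normalized with respect to
the law `Q` of the reference Poisson process. -/
def submodelDensity {d : ℕ} {b : ℝ} (Q : Measure (Configuration (Facet d b))) (c : ℕ) (ν : ℝ)
    (x : Configuration (Facet d b)) : ℝ≥0∞ :=
  (∫⁻ y, submodelWeight c ν y ∂Q)⁻¹ * submodelWeight c ν x

/-- The law of the submodel `μ_a^{(c)}`, where `Q` is the law of `η_a`. -/
def submodelLaw {d : ℕ} {b : ℝ} (Q : Measure (Configuration (Facet d b))) (c : ℕ) (ν : ℝ) :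
    Measure (Configuration (Facet d b)) :=
  Q.withDensity (submodelDensity Q c ν)

open Classical in
/-- The conditional intensity `p(x ∪ {u_1,…,u_n}) / p(x)` of order `n` of `μ_a^{(c)}`. -/
def condIntensity {d : ℕ} {b : ℝ} (Q : Measure (Configuration (Facet d b))) (c : ℕ) (ν : ℝ)
    {n : ℕ} (u : Fin n → Facet d b) (x : Configuration (Facet d b)) : ℝ≥0∞ :=
  submodelDensity Q c ν (x ∪ Finset.univ.image u) / submodelDensity Q c ν x

/-- The `n`-th correlation function of `μ_a^{(c)}`: the expected conditional intensity. -/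
def correlation {d : ℕ} {b : ℝ} (Q : Measure (Configuration (Facet d b))) (c : ℕ) (ν : ℝ)
    {n : ℕ} (u : Fin n → Facet d b) : ℝ≥0∞ :=
  ∫⁻ x, condIntensity Q c ν u x ∂(submodelLaw Q c ν)

/-- The number of distinct orientations among the given facets. -/
def numOrientations {d : ℕ} {b : ℝ} {n : ℕ} (u : Fin n → Facet d b) : ℕ :=
  (Finset.univ.image (fun i => Facet.orientation (u i))).card

end

/-! Write `n = d - c + 1`, let `m` be the intensity mass of one orientation (the same for all,
proportional to `a`), and let `K` be the set of orientations of the added facets.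

Parallel facets in different hyperplanes are disjoint, so if fewer than `c` orientations occur and
no hyperplane is repeated, then `G_c = 0` and the weight is 1 (`facetG_eq_zero`). Facets with `c`
distinct orientations meet in a set of measure bounded below (`Facet.exists_pos_le_measure_iInter`),
so more orientations are penalised.

All orientations of the Poisson process lie in a given set `A` of size `c - 1` with probability
`e^{-mn}`, and two such events overlap with probability at most `e^{-m(n+1)}`. Hence the normalizing
constant is close to `choose d n * e^{-mn}`. Once the extra facets are added, only the sets `A ⊇ K`
survive, and there are `choose (d - k) n` of them. The correlation function compares the two
expected weights, which gives the limit. For `k ≥ c` no `A` survives, so the hyperplane condition is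
not needed.

The main work is the upper bound for the expected weight (`exists_submodelWeight_le_weightBound`).
With a threshold `T = ε m`, either all but `c - 2` orientations have at most `T` facets, which is
exponentially rarer than `e^{-mn}`, or some `c - 1` orientations have at least `T` facets each, and
then every facet of another orientation costs a factor exponentially small in `m`.
`exists_normalized_bounds` collects both directions with uniform constants. -/

section PoissonProcess

/-! ### Generating functions and tail bounds for Poisson counts. -/

lemma Configuration.measurable_count {Y : Type*} [MeasurableSpace Y] {A : Set Y}
    (hA : MeasurableSet A) : Measurable (Configuration.count A) := by
  rw [measurable_iff_comap_le]
  exact le_iSup₂_of_le A hA le_rfl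

/-- The probability generating function: `r = 0` yields void probabilities and `r = e^{-τ}` Chernoff
bounds. All later expectations are products of these. -/
lemma integral_pow_poissonMeasure (t : ℝ≥0) (r : ℝ) :
    ∫ n, r ^ n ∂(poissonMeasure t) = Real.exp (-(t * (1 - r))) := by
  rw [integral_poissonMeasure]
  have h := (NormedSpace.expSeries_div_hasSum_exp (t * r : ℝ)).mul_left (Real.exp (-t))
  rw [← Real.exp_eq_exp_ℝ, ← Real.exp_add] at h
  convert! h.tsum_eq using 1
  · congr 1
    ext n
    rw [smul_eq_mul, mul_pow]
    ring
  · congr 1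
    ring

/-- Since `e^{-t} ≥ 1 - t`, one has `(1 + t) e^{-t} ≥ 1 - t²`. The quadratic order is what lets a
union bound over thin strips tend to zero. -/
lemma poissonMeasure_two_le (t : ℝ≥0) :
    poissonMeasure t {n | 2 ≤ n} ≤ (t : ℝ≥0∞) ^ 2 := by
  have hs : {n : ℕ | 2 ≤ n} = ({0} ∪ {1} : Set ℕ)ᶜ := by
    ext n
    simp
    omega
  have hr : (poissonMeasure t).real {n | 2 ≤ n} ≤ (t : ℝ) ^ 2 := by
    rw [hs, probReal_compl_eq_one_sub .of_discrete, measureReal_union (by simp) .of_discrete,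
      poissonMeasure_real_singleton, poissonMeasure_real_singleton]
    have h := Real.add_one_le_exp (-(t : ℝ))
    have ht : (0 : ℝ) ≤ t := t.2
    simp
    nlinarith
  rw [← ENNReal.ofReal_toReal (measure_ne_top (poissonMeasure t) {n | 2 ≤ n})]
  refine (ENNReal.ofReal_le_ofReal hr).trans (le_of_eq ?_)
  rw [ENNReal.ofReal_pow t.coe_nonneg, ENNReal.ofReal_coe_nnreal]

namespace IsPoissonProcess

variable {Ω Y : Type*} [MeasurableSpace Ω] [MeasurableSpace Y]

/-- The law of a Poisson process makes the identity a Poisson process. -/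
lemma law {P : Measure Ω} {Λ : Measure Y} {η : Ω → Configuration Y}
    (h : IsPoissonProcess P Λ η) : IsPoissonProcess (P.map η) Λ id where
  measurable := measurable_id
  map_count A hA := by
    rw [← h.map_count A hA]
    exact Measure.map_map (Configuration.measurable_count hA) h.measurable
  indep n A hA hd := by
    have hi := h.indep n A hA hd
    have := hi.isProbabilityMeasure
    have : IsProbabilityMeasure (P.map η) :=
      Measure.isProbabilityMeasure_map h.measurable.aemeasurable
    have hm : ∀ i, Measurable (Configuration.count (A i)) :=
      fun i => Configuration.measurable_count (hA i)
    replace hi := (iIndepFun_iff_map_fun_eq_pi_map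
      (fun i => ((hm i).comp h.measurable).aemeasurable)).1 hi
    refine (iIndepFun_iff_map_fun_eq_pi_map (fun i => (hm i).aemeasurable)).2 ?_
    rw [Measure.map_map (measurable_pi_lambda _ hm) h.measurable]
    refine hi.trans ?_
    congr 1
    ext1 i
    exact (Measure.map_map (hm i) h.measurable).symm

variable {Q : Measure (Configuration Y)} {Λ : Measure Y}

lemma map_count_id (h : IsPoissonProcess Q Λ id) {A : Set Y} (hA : MeasurableSet A) :
    Q.map (Configuration.count A) = poissonMeasure (Λ A).toNNReal :=
  h.map_count A hA

lemma integral_prod_pow_count (h : IsPoissonProcess Q Λ id) {n : ℕ} {A : Fin n → Set Y}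
    (hA : ∀ i, MeasurableSet (A i)) (hd : Pairwise (fun i j => Disjoint (A i) (A j)))
    (r : Fin n → ℝ) :
    ∫ x, ∏ i, r i ^ Configuration.count (A i) x ∂Q =
      Real.exp (-∑ i, (Λ (A i)).toReal * (1 - r i)) := by
  have hi := h.indep n A hA hd
  have hm : ∀ i, Measurable (Configuration.count (A i)) :=
    fun i => Configuration.measurable_count (hA i)
  have key := hi.integral_fun_prod_comp (f := fun i k => r i ^ k)
    (fun i => (hm i).aemeasurable) (fun i => .of_discrete)
  refine key.trans ?_
  rw [← Finset.sum_neg_distrib, Real.exp_sum]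
  refine Finset.prod_congr rfl fun i _ => ?_
  have h2 := integral_pow_poissonMeasure (Λ (A i)).toNNReal (r i)
  rw [← h.map_count_id (hA i),
    integral_map (hm i).aemeasurable (.of_discrete)] at h2
  exact h2

lemma integrable_prod_pow_count [IsProbabilityMeasure Q] {n : ℕ} {A : Fin n → Set Y}
    (hA : ∀ i, MeasurableSet (A i)) {r : Fin n → ℝ} (h0 : ∀ i, 0 ≤ r i) (h1 : ∀ i, r i ≤ 1) :
    Integrable (fun x => ∏ i, r i ^ Configuration.count (A i) x) Q := by
  refine Integrable.of_bound (C := 1) ?_ (ae_of_all _ fun x => ?_)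
  · refine Measurable.aestronglyMeasurable ?_
    refine Finset.measurable_prod _ fun i _ => ?_
    exact (measurable_of_countable (fun k : ℕ => r i ^ k)).comp
      (Configuration.measurable_count (hA i))
  · rw [Real.norm_of_nonneg (Finset.prod_nonneg fun i _ => pow_nonneg (h0 i) _)]
    exact Finset.prod_le_one (fun i _ => pow_nonneg (h0 i) _)
      (fun i _ => pow_le_one₀ (h0 i) (h1 i))

lemma measure_two_le_count (h : IsPoissonProcess Q Λ id) {A : Set Y} (hA : MeasurableSet A) :
    Q {x | 2 ≤ Configuration.count A x} ≤ Λ A ^ 2 := by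
  have h1 : Q {x | 2 ≤ Configuration.count A x} = poissonMeasure (Λ A).toNNReal {k | 2 ≤ k} := by
    rw [← h.map_count_id hA]
    exact (Measure.map_apply (Configuration.measurable_count hA) .of_discrete).symm
  rw [h1]
  refine (poissonMeasure_two_le _).trans ?_
  gcongr
  exact ENNReal.coe_toNNReal_le_self

lemma measure_count_ne_zero (h : IsPoissonProcess Q Λ id) {A : Set Y} (hA : MeasurableSet A)
    (h0 : Λ A = 0) : Q {x | Configuration.count A x ≠ 0} = 0 := by
  have h1 : Q {x | Configuration.count A x ≠ 0} = poissonMeasure (Λ A).toNNReal {k | k ≠ 0} := by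
    rw [← h.map_count_id hA]
    exact (Measure.map_apply (s := {k | k ≠ 0}) (Configuration.measurable_count hA)
      .of_discrete).symm
  have hs : {k : ℕ | k ≠ 0} = ({0} : Set ℕ)ᶜ := rfl
  rw [h1, h0, hs, prob_compl_eq_zero_iff .of_discrete, poissonMeasure_singleton]
  simp

end IsPoissonProcess

end PoissonProcess

/-! ### Intersections of facets and bounds on the weight. -/

section Geometry

/-- Projection to the coordinates in `S`, with the sup norm on the target, is 1-Lipschitz and so
does not increase Hausdorff measure. The image contains the cube `[0,b]^n`, and there sup-norm
Hausdorff measure is Lebesgue measure. -/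
lemma exists_pos_le_euclideanHausdorffMeasure (d n : ℕ) {b : ℝ} (hb : 0 < b) :
    ∃ κ : ℝ, 0 < κ ∧ ∀ (S : Finset (Fin d)) (K : Set (EuclideanSpace ℝ (Fin d))), S.card = n →
      (∀ v : S → ℝ, (∀ i, v i ∈ Set.Icc 0 b) → ∃ x ∈ K, ∀ i : S, x i = v i) →
      ENNReal.ofReal κ ≤ (Measure.euclideanHausdorffMeasure n : Measure _) K := by
  set s : ℝ≥0 := Measure.addHaarScalarFactor (volume : Measure (EuclideanSpace ℝ (Fin n)))
    (Measure.hausdorffMeasure n) with hs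
  have hs0 : s ≠ 0 := Measure.addHaarScalarFactor_volume_hausdorffMeasure_ne_zero n
  refine ⟨s * b ^ n, mul_pos (by positivity) (by positivity), ?_⟩
  rintro S K rfl hK
  let π : EuclideanSpace ℝ (Fin d) → (S → ℝ) := fun x i => x i
  have hπ : LipschitzWith 1 π := by
    refine LipschitzWith.of_dist_le_mul fun x y => ?_
    rw [NNReal.coe_one, one_mul]
    refine (dist_pi_le_iff dist_nonneg).2 fun i => ?_
    rw [dist_eq_norm, dist_eq_norm]
    exact PiLp.norm_apply_le (x - y) i.1
  have h1 := hπ.hausdorffMeasure_image_le (d := S.card) (by positivity) K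
  rw [ENNReal.coe_one, ENNReal.one_rpow, one_mul] at h1
  have h2 : Set.Icc (0 : S → ℝ) (fun _ => b) ⊆ π '' K := by
    intro v hv
    obtain ⟨x, hx, hxv⟩ := hK v fun i => ⟨hv.1 i, hv.2 i⟩
    exact ⟨x, hx, funext hxv⟩
  have h3 : volume (Set.Icc (0 : S → ℝ) (fun _ => b)) = ENNReal.ofReal (b ^ S.card) := by
    rw [Real.volume_Icc_pi]
    simp [ENNReal.ofReal_pow hb.le]
  have h4 : (Measure.hausdorffMeasure (S.card : ℝ) : Measure (S → ℝ)) = volume := by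
    rw [← hausdorffMeasure_pi_real (ι := S), Fintype.card_coe]
  rw [Measure.euclideanHausdorffMeasure_def, ← hs, Measure.smul_apply, ENNReal.smul_def,
    smul_eq_mul, ENNReal.ofReal_mul s.coe_nonneg, ENNReal.ofReal_coe_nnreal]
  gcongr
  rw [← h3, ← h4]
  exact (measure_mono h2).trans h1

/-- The facets with orientation `e_l`. -/
def Facet.withOrientation {d : ℕ} {b : ℝ} (l : Fin d) : Set (Facet d b) :=
  {y | Facet.orientation y = l}

lemma Facet.centre_mem {d : ℕ} {b : ℝ} (y : Facet d b) (i : Fin d) :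
    Facet.centre y i ∈ Set.Icc 0 b :=
  ⟨y.1.2.1 i, y.1.2.2 i⟩

/-- The half-width `b` is large enough that any point of `[0,b]^d` satisfies all the side
constraints. Only the `c` normal coordinates are prescribed, and distinct orientations prescribe
them consistently. -/
lemma Facet.exists_mem_iInter_toSet {d c : ℕ} {b : ℝ} (t : Fin c → Facet d b)
    (ht : Function.Injective fun i => Facet.orientation (t i)) (v : Fin d → ℝ)
    (hv : ∀ j, (∀ i, Facet.orientation (t i) ≠ j) → v j ∈ Set.Icc 0 b) :
    ∃ x ∈ ⋂ i, Facet.toSet (t i), ∀ j, (∀ i, Facet.orientation (t i) ≠ j) → x j = v j := by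
  classical
  let f : Fin d → ℝ := fun j =>
    if h : ∃ i, Facet.orientation (t i) = j then Facet.centre (t h.choose) j else v j
  have hf : ∀ i, f (Facet.orientation (t i)) =
      Facet.centre (t i) (Facet.orientation (t i)) := by
    intro i
    have h : ∃ i', Facet.orientation (t i') = Facet.orientation (t i) := ⟨i, rfl⟩
    have h' : h.choose = i := ht h.choose_spec
    simp only [f, dif_pos h, h']
  have hfm : ∀ j, f j ∈ Set.Icc 0 b := by
    intro j
    by_cases h : ∃ i, Facet.orientation (t i) = j
    · simp only [f, dif_pos h]
      exact Facet.centre_mem _ _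
    · simp only [f, dif_neg h]
      exact hv j (by simpa using h)
  refine ⟨WithLp.toLp 2 f, ?_, ?_⟩
  · refine Set.mem_iInter.2 fun i => ⟨hf i, fun j _ => ?_⟩
    have h1 := hfm j
    have h2 := Facet.centre_mem (t i) j
    change |f j - _| ≤ b
    rw [abs_le]
    constructor <;> linarith [h1.1, h1.2, h2.1, h2.2]
  · intro j hj
    have h : ¬ ∃ i, Facet.orientation (t i) = j := by simpa using hj
    exact dif_neg h

lemma Facet.exists_pos_le_measure_iInter (d c : ℕ) {b : ℝ} (hb : 0 < b) :
    ∃ κ : ℝ, 0 < κ ∧ ∀ t : Fin c → Facet d b,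
      (Function.Injective fun i => Facet.orientation (t i)) →
      ENNReal.ofReal κ ≤ (Measure.euclideanHausdorffMeasure (d - c) :
        Measure (EuclideanSpace ℝ (Fin d))) (⋂ i, Facet.toSet (t i)) := by
  classical
  obtain ⟨κ, hκ, h⟩ := exists_pos_le_euclideanHausdorffMeasure d (d - c) hb
  refine ⟨κ, hκ, fun t ht => h (Finset.univ.image fun i => Facet.orientation (t i))ᶜ _ ?_ ?_⟩
  · rw [Finset.card_compl, Finset.card_image_of_injective _ ht]
    simp
  · intro v hv
    obtain ⟨x, hx, hxv⟩ := Facet.exists_mem_iInter_toSet t ht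
      (fun j => if hj : _ then v ⟨j, hj⟩ else 0) (fun j hj => by
        have : j ∈ (Finset.univ.image fun i => Facet.orientation (t i))ᶜ := by simpa using hj
        simp only [dif_pos this]
        exact hv _)
    refine ⟨x, hx, fun i => ?_⟩
    have hi : ∀ k, Facet.orientation (t k) ≠ i.1 := fun k hk =>
      Finset.mem_compl.1 i.2 (Finset.mem_image.2 ⟨k, Finset.mem_univ _, hk⟩)
    rw [hxv i.1 hi, dif_pos i.2]

open Classical in
-- By pigeonhole every `c`-tuple contains two parallel facets, which are disjoint because their
-- hyperplanes differ.
lemma facetG_eq_zero {d c : ℕ} {b : ℝ} {X : Configuration (Facet d b)} {A : Finset (Fin d)}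
    (hA : A.card < c) (hXA : ∀ y ∈ X, Facet.orientation y ∈ A)
    (hX : ∀ y ∈ X, ∀ y' ∈ X, y ≠ y' → ¬ Facet.SameHyperplane y y') : facetG c X = 0 := by
  refine Finset.sum_eq_zero fun t _ => ?_
  obtain ⟨i, j, hij, h⟩ := Fintype.exists_ne_map_eq_of_card_lt
    (fun i : Fin c => (⟨Facet.orientation (t i).1, hXA _ (t i).2⟩ : A)) (by simpa using hA)
  have ho : Facet.orientation (t i).1 = Facet.orientation (t j).1 := congrArg Subtype.val h
  have hne : (t i).1 ≠ (t j).1 := fun h => hij (t.injective (Subtype.ext h))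
  have he : (⋂ i, Facet.toSet (t i).1) = ∅ := by
    refine Set.eq_empty_of_forall_notMem fun x hx => ?_
    have hi := (Set.mem_iInter.1 hx i).1
    have hj := (Set.mem_iInter.1 hx j).1
    refine hX _ (t i).2 _ (t j).2 hne ⟨ho, ?_⟩
    rw [← hi, ho, hj]
  rw [he, measure_empty, mul_zero]

open Classical in
-- Choosing one facet of each orientation in `A` and one facet outside gives a tuple with distinct
-- orientations. Each choice is counted in a single fixed order (via `Option A`), so the factor
-- `1/c!` stays.
lemma le_facetG {d c : ℕ} {b κ : ℝ}
    (hκ : ∀ t : Fin c → Facet d b, (Function.Injective fun i => Facet.orientation (t i)) →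
      ENNReal.ofReal κ ≤ (Measure.euclideanHausdorffMeasure (d - c) :
        Measure (EuclideanSpace ℝ (Fin d))) (⋂ i, Facet.toSet (t i)))
    {A : Finset (Fin d)} (hA : A.card + 1 = c) (X : Configuration (Facet d b)) :
    (((∏ i ∈ A, Configuration.count (Facet.withOrientation i) X) *
      Configuration.count {y | Facet.orientation y ∉ A} X : ℕ) : ℝ≥0∞) *
      ((c.factorial : ℝ≥0∞)⁻¹ * ENNReal.ofReal κ) ≤ facetG c X := by
  let V : A → Type := fun i => {y // y ∈ X.filter (fun y => y ∈ Facet.withOrientation i.1)}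
  let W : Type := {y // y ∈ X.filter (fun y => y ∈ {y | Facet.orientation y ∉ A})}
  have e : Fin c ≃ Option A := Fintype.equivOfCardEq (by simp [hA])
  let g : ((i : A) → V i) × W → Option A → {y // y ∈ X} := fun p o =>
    o.elim ⟨p.2.1, (Finset.mem_filter.1 p.2.2).1⟩
      (fun i => ⟨(p.1 i).1, (Finset.mem_filter.1 (p.1 i).2).1⟩)
  have hgs : ∀ p (i : A), Facet.orientation (g p (some i)).1 = i.1 := fun p i =>
    (Finset.mem_filter.1 (p.1 i).2).2
  have hgn : ∀ p, Facet.orientation (g p none).1 ∉ A := fun p =>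
    (Finset.mem_filter.1 p.2.2).2
  have hginj : ∀ p, Function.Injective fun o => Facet.orientation (g p o).1 := by
    rintro p (_ | i) (_ | j) h
    · rfl
    · have h2 : Facet.orientation (g p none).1 = j.1 := h.trans (hgs p j)
      exact absurd (by rw [h2]; exact j.2) (hgn p)
    · have h2 : Facet.orientation (g p none).1 = i.1 := h.symm.trans (hgs p i)
      exact absurd (by rw [h2]; exact i.2) (hgn p)
    · exact congrArg some (Subtype.ext ((hgs p i).symm.trans (h.trans (hgs p j))))
  have hinj : ∀ p, Function.Injective fun k => Facet.orientation (g p (e k)).1 :=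
    fun p => (hginj p).comp e.injective
  let F : ((i : A) → V i) × W ↪ (Fin c ↪ {y // y ∈ X}) :=
    ⟨fun p => ⟨fun k => g p (e k), fun k l h => hinj p (by
        change Facet.orientation (g p (e k)).1 = Facet.orientation (g p (e l)).1
        exact congrArg (fun z => Facet.orientation z.1) h)⟩, by
      intro p p' h
      have h' : ∀ o, g p o = g p' o := fun o => by
        have := DFunLike.congr_fun h (e.symm o)
        change g p (e (e.symm o)) = g p' (e (e.symm o)) at this
        rwa [e.apply_symm_apply] at this
      refine Prod.ext (funext fun i => Subtype.ext ?_) (Subtype.ext ?_)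
      · have := congrArg Subtype.val (h' (some i))
        exact this
      · have := congrArg Subtype.val (h' none)
        exact this⟩
  have hcard : ((∏ i ∈ A, Configuration.count (Facet.withOrientation i) X) *
      Configuration.count {y | Facet.orientation y ∉ A} X) =
      Fintype.card (((i : A) → V i) × W) := by
    rw [Fintype.card_prod, Fintype.card_pi, ← Finset.prod_coe_sort]
    congr 1
    · exact Finset.prod_congr rfl fun i _ => (Fintype.card_coe _).symm
    · rw [Configuration.count]
      convert (Fintype.card_coe _).symm
  rw [hcard, ← Finset.card_univ, ← nsmul_eq_mul, ← Finset.card_map F]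
  unfold facetG
  refine (Finset.card_nsmul_le_sum _ _ _ ?_).trans
    (Finset.sum_le_sum_of_subset (Finset.subset_univ (Finset.univ.map F)))
  intro t ht
  obtain ⟨p, -, rfl⟩ := Finset.mem_map.1 ht
  gcongr
  exact hκ _ (hinj p)

lemma submodelWeight_eq_one {d c : ℕ} {b ν : ℝ} {X : Configuration (Facet d b)}
    (h : facetG c X = 0) : submodelWeight c ν X = 1 := by
  simp [submodelWeight, h]

lemma submodelWeight_le_one {d c : ℕ} {b ν : ℝ} (hν : ν < 0) (X : Configuration (Facet d b)) :
    submodelWeight c ν X ≤ 1 := by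
  rw [submodelWeight, EReal.exp_le_one_iff]
  exact EReal.mul_nonpos_iff.2 (Or.inr ⟨by exact_mod_cast hν.le, by positivity⟩)

lemma submodelWeight_le {d c : ℕ} {b ν s : ℝ} (hν : ν < 0) (hs : 0 ≤ s)
    {X : Configuration (Facet d b)} (h : ENNReal.ofReal s ≤ facetG c X) :
    submodelWeight c ν X ≤ ENNReal.ofReal (Real.exp (ν * s)) := by
  rw [submodelWeight, ← EReal.exp_coe, EReal.exp_le_exp_iff, EReal.coe_mul]
  have h1 : ((s : ℝ) : EReal) ≤ (facetG c X : EReal) := by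
    rw [← max_eq_left hs, ← EReal.coe_ennreal_ofReal]
    exact_mod_cast h
  have h2 := mul_le_mul_of_nonneg_left h1
    (show (0 : EReal) ≤ ((-ν : ℝ) : EReal) by exact_mod_cast (neg_pos.2 hν).le)
  rw [EReal.coe_neg, EReal.neg_mul, EReal.neg_mul, EReal.neg_le_neg_iff] at h2
  exact h2

end Geometry

/-! ### Pointwise bounds in terms of the numbers of facets of each orientation. -/

section PointwiseBounds

/-- The number of facets of a configuration with orientation `e_l`. -/
noncomputable def numWithOrientation {d : ℕ} {b : ℝ} (x : Configuration (Facet d b))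
    (l : Fin d) : ℕ :=
  Configuration.count (Facet.withOrientation l) x

/-- The set of orientations of a finite family of facets. -/
def orientations {d : ℕ} {b : ℝ} {p : ℕ} (u : Fin p → Facet d b) : Finset (Fin d) :=
  Finset.univ.image fun i => Facet.orientation (u i)

open Classical in
lemma Configuration.count_mono {Y : Type*} (A : Set Y) {x X : Configuration Y} (h : x ⊆ X) :
    Configuration.count A x ≤ Configuration.count A X :=
  Finset.card_le_card (Finset.filter_subset_filter _ h)

open Classical in
lemma Configuration.count_pos {Y : Type*} {A : Set Y} {x : Configuration Y} {y : Y}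
    (hy : y ∈ x) (hA : y ∈ A) : 0 < Configuration.count A x :=
  Finset.card_pos.2 ⟨y, Finset.mem_filter.2 ⟨hy, hA⟩⟩

open Classical in
lemma Configuration.count_eq_zero {Y : Type*} {A : Set Y} {x : Configuration Y} :
    Configuration.count A x = 0 ↔ ∀ y ∈ x, y ∉ A := by
  rw [Configuration.count, Finset.card_eq_zero, Finset.filter_eq_empty_iff]

open Classical in
lemma count_orientation_notMem {d : ℕ} {b : ℝ} (A : Finset (Fin d))
    (x : Configuration (Facet d b)) :
    Configuration.count {y | Facet.orientation y ∉ A} x = ∑ j ∈ Aᶜ, numWithOrientation x j := by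
  rw [Configuration.count, Finset.card_eq_sum_card_fiberwise (f := Facet.orientation) (t := Aᶜ)
    (fun y hy => by simp at hy ⊢; exact hy.2)]
  refine Finset.sum_congr rfl fun j hj => ?_
  rw [numWithOrientation, Configuration.count, Finset.filter_filter]
  congr 1
  ext y
  have := Finset.mem_compl.1 hj
  simp only [Finset.mem_filter]
  constructor
  · rintro ⟨h1, _, h3⟩
    exact ⟨h1, h3⟩
  · rintro ⟨h1, h3⟩
    exact ⟨h1, fun h => this (h3 ▸ h), h3⟩

/-- The product `∏ r_j ^ N_j` over the orientations outside `A`. -/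
noncomputable def powCount {d : ℕ} {b : ℝ} (A : Finset (Fin d)) (r : ℝ)
    (x : Configuration (Facet d b)) : ℝ :=
  ∏ j, (if j ∈ A then 1 else r) ^ numWithOrientation x j

lemma powCount_nonneg {d : ℕ} {b : ℝ} (A : Finset (Fin d)) {r : ℝ} (hr : 0 ≤ r)
    (x : Configuration (Facet d b)) : 0 ≤ powCount A r x :=
  Finset.prod_nonneg fun j _ => pow_nonneg (by split_ifs <;> positivity) _

lemma powCount_eq {d : ℕ} {b : ℝ} (A : Finset (Fin d)) (r : ℝ) (x : Configuration (Facet d b)) :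
    powCount A r x = r ^ Configuration.count {y | Facet.orientation y ∉ A} x := by
  rw [count_orientation_notMem, ← Finset.prod_pow_eq_pow_sum, powCount,
    ← Finset.prod_mul_prod_compl A, Finset.prod_eq_one, one_mul]
  · refine Finset.prod_congr rfl fun j hj => ?_
    rw [if_neg (Finset.mem_compl.1 hj)]
  · intro j hj
    rw [if_pos hj, one_pow]

open Classical in
/-- An upper bound for the weight of `x ∪ {u_1, …, u_p}`, in terms of the numbers of facets of
`x` with given orientations. -/
noncomputable def weightBound (d c : ℕ) {b : ℝ} (κ τ T : ℝ) (K : Finset (Fin d))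
    (x : Configuration (Facet d b)) : ℝ :=
  ∑ D ∈ Finset.univ.powersetCard (c - 2), Real.exp (τ * T) ^ Dᶜ.card *
      powCount D (Real.exp (-τ)) x +
    ∑ A ∈ Finset.univ.powersetCard (c - 1), (if K ⊆ A then 1 else Real.exp (-(κ * T))) *
      powCount A (Real.exp (-(κ * T))) x

/-- The pointwise form of Chernoff's inequality: each orientation outside `D` contributes `e^{τ(T -
N_j)} ≥ 1`. -/
lemma one_le_exp_mul_powCount {d : ℕ} {b τ T : ℝ} (hτ : 0 ≤ τ) {D : Finset (Fin d)}
    {x : Configuration (Facet d b)} (hx : ∀ j ∉ D, (numWithOrientation x j : ℝ) ≤ T) :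
    1 ≤ Real.exp (τ * T) ^ Dᶜ.card * powCount D (Real.exp (-τ)) x := by
  rw [powCount_eq, count_orientation_notMem, ← Finset.prod_pow_eq_pow_sum,
    ← Finset.prod_const, ← Finset.prod_mul_distrib]
  refine Finset.one_le_prod fun j hj => ?_
  rw [← Real.exp_nat_mul, ← Real.exp_add]
  have := hx j (Finset.mem_compl.1 hj)
  exact Real.one_le_exp (by nlinarith)

open Classical in
-- Split on the number of orientations with at least `T` facets. If there are at most `c - 2`, the
-- Chernoff term alone exceeds 1. Otherwise `c - 1` of them form a set `A`, and `le_facetG` makes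
-- each facet outside `A` cost a factor `e^{-2κT}`.
lemma exists_submodelWeight_le_weightBound {d c : ℕ} (hc : 2 ≤ c) (hcd : c ≤ d) {b : ℝ}
    (hb : 0 < b) {ν : ℝ} (hν : ν < 0) :
    ∃ κ : ℝ, 0 < κ ∧ ∀ {p : ℕ} (u : Fin p → Facet d b) (τ T : ℝ), 0 ≤ τ → 0 < T →
      ∀ x : Configuration (Facet d b),
        submodelWeight c ν (x ∪ Finset.univ.image u) ≤
          ENNReal.ofReal (weightBound d c κ τ T (orientations u) x) := by
  obtain ⟨κ₀, hκ₀, hκ⟩ := Facet.exists_pos_le_measure_iInter d c hb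
  set s : ℝ := (c.factorial : ℝ)⁻¹ * κ₀ with hs
  have hs0 : 0 < s := by positivity
  -- Half of the available rate: when `K ⊄ A`, one half pays for the prefactor `e^{-κT}` and the
  -- other for the powers of `e^{-κT}`.
  refine ⟨-ν * s / 2, by nlinarith [mul_pos (neg_pos.2 hν) hs0], ?_⟩
  intro p u τ T hτ hT x
  set X := x ∪ Finset.univ.image u
  set κ := -ν * s / 2 with hκdef
  have hn1 : ∀ D ∈ Finset.univ.powersetCard (c - 2), 0 ≤ Real.exp (τ * T) ^ Dᶜ.card *
      powCount D (Real.exp (-τ)) x := fun D _ =>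
    mul_nonneg (by positivity) (powCount_nonneg _ (Real.exp_pos _).le _)
  have hn2 : ∀ A ∈ Finset.univ.powersetCard (c - 1),
      0 ≤ (if orientations u ⊆ A then 1 else Real.exp (-(κ * T))) *
      powCount A (Real.exp (-(κ * T))) x := fun A _ =>
    mul_nonneg (by split_ifs <;> positivity) (powCount_nonneg _ (Real.exp_pos _).le _)
  let L : Finset (Fin d) := Finset.univ.filter fun j => T ≤ numWithOrientation x j
  rcases le_or_gt L.card (c - 2) with hL | hL
  · obtain ⟨D, hLD, hD⟩ := Finset.exists_superset_card_eq hL (by simp; omega)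
    have hDm : D ∈ (Finset.univ : Finset (Fin d)).powersetCard (c - 2) :=
      Finset.mem_powersetCard.2 ⟨Finset.subset_univ _, hD⟩
    have h1 : 1 ≤ weightBound d c κ τ T (orientations u) x := by
      have h2 := one_le_exp_mul_powCount (x := x) (T := T) hτ (D := D) fun j hj => by
        by_contra hlt
        exact hj (hLD (Finset.mem_filter.2 ⟨Finset.mem_univ _, (not_le.1 hlt).le⟩))
      have h3 := Finset.single_le_sum hn1 hDm
      exact (h2.trans h3).trans (le_add_of_nonneg_right (Finset.sum_nonneg hn2))
    exact (submodelWeight_le_one hν X).trans (by simpa using ENNReal.ofReal_le_ofReal h1)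
  · obtain ⟨A, hAL, hA⟩ := Finset.exists_subset_card_eq (show c - 1 ≤ L.card by omega)
    have hAm : A ∈ (Finset.univ : Finset (Fin d)).powersetCard (c - 1) :=
      Finset.mem_powersetCard.2 ⟨Finset.subset_univ _, hA⟩
    have hxX : x ⊆ X := Finset.subset_union_left
    have hNX : ∀ i ∈ A, T ≤ Configuration.count (Facet.withOrientation i) X := fun i hi =>
      (Finset.mem_filter.1 (hAL hi)).2.trans
        (by exact_mod_cast Configuration.count_mono _ hxX)
    obtain ⟨i₀, hi₀⟩ := Finset.card_pos.1 (show 0 < A.card by omega)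
    -- One factor is at least `T`; the others are positive integers, so they are at least 1 even
    -- when `T < 1`.
    have hprod : T ≤ ((∏ i ∈ A, Configuration.count (Facet.withOrientation i) X : ℕ) : ℝ) := by
      refine (hNX i₀ hi₀).trans ?_
      exact_mod_cast Finset.single_le_prod' (f := fun i =>
        Configuration.count (Facet.withOrientation i) X) (fun i hi => by
          have : (0 : ℝ) < Configuration.count (Facet.withOrientation i) X :=
            hT.trans_le (hNX i hi)
          have : 0 < Configuration.count (Facet.withOrientation i) X := by exact_mod_cast this
          exact this) hi₀
    set M := Configuration.count {y | Facet.orientation y ∉ A} X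
    set M₀ := Configuration.count {y | Facet.orientation y ∉ A} x with hM₀
    have hMM₀ : M₀ ≤ M := Configuration.count_mono _ hxX
    have hG := le_facetG hκ (show A.card + 1 = c by omega) X
    have hG' : ENNReal.ofReal (T * M * s) ≤ facetG c X := by
      refine le_trans ?_ hG
      have : (((c.factorial : ℝ≥0∞)⁻¹ * ENNReal.ofReal κ₀)) = ENNReal.ofReal s := by
        rw [hs, ENNReal.ofReal_mul (by positivity), ENNReal.ofReal_inv_of_pos (by positivity),
          ENNReal.ofReal_natCast]
      rw [this, ← ENNReal.ofReal_natCast, ← ENNReal.ofReal_mul (by positivity)]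
      refine ENNReal.ofReal_le_ofReal ?_
      rw [Nat.cast_mul]
      gcongr
    have hw := submodelWeight_le hν (by positivity) hG'
    refine hw.trans (ENNReal.ofReal_le_ofReal ?_)
    have h3 := Finset.single_le_sum hn2 hAm
    refine le_trans ?_ (h3.trans (le_add_of_nonneg_left (Finset.sum_nonneg hn1)))
    have hκT : 0 ≤ κ * T := mul_nonneg (by nlinarith [mul_pos (neg_pos.2 hν) hs0]) hT.le
    have he : ν * (T * M * s) = -(κ * T) * (2 * M) := by rw [hκdef]; ring
    have hMc : (M₀ : ℝ) ≤ M := by exact_mod_cast hMM₀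
    rw [powCount_eq, ← hM₀, ← Real.exp_nat_mul, he]
    split_ifs with hK
    · rw [one_mul]
      refine Real.exp_le_exp.2 ?_
      have hM0 : (0 : ℝ) ≤ M := by positivity
      nlinarith
    · obtain ⟨j, hj, hjA⟩ := Finset.not_subset.1 hK
      obtain ⟨i, -, rfl⟩ := Finset.mem_image.1 hj
      have hM1 : 0 < M := Configuration.count_pos (y := u i)
        (Finset.mem_union_right _ (Finset.mem_image_of_mem _ (Finset.mem_univ _))) hjA
      have hM1' : (1 : ℝ) ≤ M := by exact_mod_cast hM1
      rw [← Real.exp_add]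
      refine Real.exp_le_exp.2 ?_
      nlinarith

/-- The configurations whose orientations, together with those in `K`, number less than `c`. -/
def fewOrientations (d c : ℕ) (b : ℝ) (K : Finset (Fin d)) : Set (Configuration (Facet d b)) :=
  ⋃ A ∈ {A : Finset (Fin d) | A.card = c - 1 ∧ K ⊆ A},
    {x | Configuration.count {y | Facet.orientation y ∉ A} x = 0}

/-- A Bonferroni-type bound. With `r = 0`, `powCount` is the indicator that no orientation outside
the set occurs, so each summand is at most the indicator that the occurring orientations are exactly
`A`. These events are disjoint. -/
lemma sum_powCount_le_indicator {d c : ℕ} {b : ℝ} (K : Finset (Fin d))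
    (x : Configuration (Facet d b)) :
    ∑ A ∈ (Finset.univ.powersetCard (c - 1)).filter (K ⊆ ·),
      (powCount A 0 x - ∑ i ∈ A, powCount (A.erase i) 0 x) ≤
      (fewOrientations d c b K).indicator 1 x := by
  let S : Finset (Fin d) := Finset.univ.filter fun j => numWithOrientation x j ≠ 0
  have hS : ∀ A, Configuration.count {y | Facet.orientation y ∉ A} x = 0 ↔ S ⊆ A := by
    intro A
    rw [count_orientation_notMem, Finset.sum_eq_zero_iff]
    simp only [Finset.subset_iff, S, Finset.mem_filter, Finset.mem_univ, true_and,
      Finset.mem_compl]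
    exact forall_congr' fun j => ⟨fun h hj => by_contra fun hA => hj (h hA),
      fun h hA => by_contra fun hj => hA (h hj)⟩
  have hp : ∀ A, powCount A 0 x = if S ⊆ A then 1 else 0 := by
    intro A
    rw [powCount_eq]
    split_ifs with h
    · rw [(hS A).2 h, pow_zero]
    · exact zero_pow fun h' => h ((hS A).1 h')
  have hterm : ∀ A, powCount A 0 x - ∑ i ∈ A, powCount (A.erase i) 0 x ≤
      if S = A then (1 : ℝ) else 0 := by
    intro A
    have hnn : ∀ i ∈ A, 0 ≤ powCount (A.erase i) 0 x := fun i _ => powCount_nonneg _ le_rfl _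
    have hsum := Finset.sum_nonneg hnn
    by_cases hSA : S = A
    · rw [if_pos hSA, hp A, if_pos hSA.subset]
      linarith
    · rw [if_neg hSA]
      by_cases h : S ⊆ A
      · obtain ⟨i, hiA, hiS⟩ := Finset.exists_of_ssubset (h.ssubset_of_ne hSA)
        have h1 := Finset.single_le_sum hnn hiA
        rw [hp (A.erase i), if_pos (Finset.subset_erase.2 ⟨h, hiS⟩)] at h1
        rw [hp A, if_pos h]
        linarith
      · rw [hp A, if_neg h]
        linarith
  refine (Finset.sum_le_sum fun A _ => hterm A).trans ?_
  rw [Finset.sum_ite_eq]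
  split_ifs with hm
  · obtain ⟨h1, h2⟩ := Finset.mem_filter.1 hm
    rw [Set.indicator_of_mem]
    · simp
    · exact Set.mem_biUnion (x := S) ⟨(Finset.mem_powersetCard.1 h1).2, h2⟩
        ((hS S).2 subset_rfl)
  · exact Set.indicator_nonneg (fun _ _ => zero_le_one) _

end PointwiseBounds

/-! ### The intensity measure: strips and single orientations. -/

section FacetMeasure

variable {d : ℕ} {b : ℝ}

/-- The facets with orientation `e_l` whose supporting hyperplane meets the `l`-th axis in `I`. -/
def Facet.strip (l : Fin d) (I : Set ℝ) : Set (Facet d b) :=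
  {y | Facet.orientation y = l ∧ Facet.centre y l ∈ I}

lemma Facet.strip_eq_prod (l : Fin d) (I : Set ℝ) :
    (Facet.strip l I : Set (Facet d b)) = {z : Window d b | z.1 l ∈ I} ×ˢ {l} := by
  ext y
  exact and_comm

lemma Facet.measurableSet_withOrientation (l : Fin d) :
    MeasurableSet (Facet.withOrientation l : Set (Facet d b)) :=
  measurable_snd (measurableSet_singleton l)

lemma Facet.measurableSet_orientation_notMem (A : Finset (Fin d)) :
    MeasurableSet {y : Facet d b | Facet.orientation y ∉ A} :=
  measurable_snd (t := {l | l ∉ A}) .of_discrete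

lemma Facet.measurableSet_strip (l : Fin d) {I : Set ℝ} (hI : MeasurableSet I) :
    MeasurableSet (Facet.strip l I : Set (Facet d b)) := by
  rw [Facet.strip_eq_prod]
  exact ((measurable_pi_apply l).comp measurable_subtype_coe hI).prod (measurableSet_singleton l)

lemma facetMeasure_prod_singleton (χ : Window d b → ℝ≥0) (B : Set (Window d b)) (l : Fin d) :
    facetMeasure χ (B ×ˢ {l}) =
      (Measure.comap Subtype.val (volume : Measure (Fin d → ℝ))).withDensity
        (fun z => (χ z : ℝ≥0∞)) B * (d : ℝ≥0∞)⁻¹ := by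
  rw [facetMeasure, Measure.prod_prod]
  congr 1
  rw [Measure.smul_apply, Measure.finsetSum_apply]
  simp [Set.indicator_apply]

lemma facetMeasure_withOrientation (χ : Window d b → ℝ≥0) (l : Fin d) :
    facetMeasure χ (Facet.withOrientation l) =
      (Measure.comap Subtype.val (volume : Measure (Fin d → ℝ))).withDensity
        (fun z => (χ z : ℝ≥0∞)) Set.univ * (d : ℝ≥0∞)⁻¹ := by
  rw [← facetMeasure_prod_singleton χ Set.univ l]
  congr 1
  ext y
  simp [Facet.withOrientation, Facet.orientation]

lemma exists_facetMeasure_strip_le {χ : Window d b → ℝ≥0} (hχ : ∃ M : ℝ≥0, ∀ z, χ z ≤ M) :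
    ∃ C : ℝ≥0, ∀ (l : Fin d) (I : Set ℝ), MeasurableSet I →
      facetMeasure χ (Facet.strip l I) ≤ C * volume I := by
  obtain ⟨M, hM⟩ := hχ
  refine ⟨M * b.toNNReal ^ (d - 1), fun l I hI => ?_⟩
  have hd : (d : ℝ≥0∞)⁻¹ ≤ 1 := by
    have : 1 ≤ d := l.pos
    exact ENNReal.inv_le_one.2 (by exact_mod_cast this)
  have hB : MeasurableSet {z : Window d b | z.1 l ∈ I} :=
    (measurable_pi_apply l).comp measurable_subtype_coe hI
  have hW : MeasurableSet (Set.Icc (0 : Fin d → ℝ) (fun _ => b)) := measurableSet_Icc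
  have h1 : Measure.comap Subtype.val (volume : Measure (Fin d → ℝ))
      {z : Window d b | z.1 l ∈ I} ≤ b.toNNReal ^ (d - 1) * volume I := by
    rw [(MeasurableEmbedding.subtype_coe hW).comap_apply]
    calc volume (Subtype.val '' {z : Window d b | z.1 l ∈ I})
        ≤ volume (Set.univ.pi fun i : Fin d => if i = l then I else Set.Icc 0 b) := by
          refine measure_mono ?_
          rintro _ ⟨z, hz, rfl⟩ i -
          dsimp only
          split_ifs with h
          · rw [h]; exact hz
          · exact ⟨z.2.1 i, z.2.2 i⟩
      _ = b.toNNReal ^ (d - 1) * volume I := by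
          rw [volume_pi_pi, ← Finset.mul_prod_erase _ _ (Finset.mem_univ l), if_pos rfl, mul_comm]
          congr 1
          rw [Finset.prod_congr rfl (g := fun _ => ((b.toNNReal : ℝ≥0) : ℝ≥0∞)),
            Finset.prod_const, Finset.card_erase_of_mem (Finset.mem_univ l)]
          · simp
          · intro i hi
            rw [if_neg (Finset.ne_of_mem_erase hi), Real.volume_Icc, sub_zero]
            rfl
  rw [Facet.strip_eq_prod, facetMeasure_prod_singleton]
  refine (mul_le_of_le_one_right' hd).trans ?_
  rw [withDensity_apply _ hB]
  calc ∫⁻ z in {z : Window d b | z.1 l ∈ I}, (χ z : ℝ≥0∞)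
        ∂(Measure.comap Subtype.val (volume : Measure (Fin d → ℝ)))
      ≤ ∫⁻ _ in {z : Window d b | z.1 l ∈ I}, (M : ℝ≥0∞)
        ∂(Measure.comap Subtype.val (volume : Measure (Fin d → ℝ))) :=
        lintegral_mono fun z => ENNReal.coe_le_coe.2 (hM z)
    _ ≤ M * (b.toNNReal ^ (d - 1) * volume I) := by
        rw [setLIntegral_const]
        gcongr
    _ = _ := by
        push_cast
        rw [mul_assoc]

lemma facetMeasure_withOrientation_ne_top {χ : Window d b → ℝ≥0}
    (hχ : ∃ M : ℝ≥0, ∀ z, χ z ≤ M) (l : Fin d) :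
    facetMeasure χ (Facet.withOrientation l) ≠ ∞ := by
  obtain ⟨C, hC⟩ := exists_facetMeasure_strip_le hχ
  have h : (Facet.withOrientation l : Set (Facet d b)) ⊆ Facet.strip l (Set.Icc 0 b) :=
    fun y hy => ⟨hy, Facet.centre_mem y l⟩
  refine ((measure_mono h).trans (hC l _ measurableSet_Icc)).trans_lt ?_ |>.ne
  exact ENNReal.mul_lt_top ENNReal.coe_lt_top measure_Icc_lt_top

lemma facetMeasure_withOrientation_ne_zero {χ : Window d b → ℝ≥0}
    (hχ : facetMeasure χ ≠ 0) (l : Fin d) :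
    facetMeasure χ (Facet.withOrientation l) ≠ 0 := by
  intro h
  refine hχ (Measure.measure_univ_eq_zero.1 ?_)
  have hu : (Set.univ : Set (Facet d b)) ⊆ ⋃ l' : Fin d, Facet.withOrientation l' :=
    fun y _ => Set.mem_iUnion.2 ⟨Facet.orientation y, rfl⟩
  refine measure_mono_null hu (measure_iUnion_null fun l' => ?_)
  rw [facetMeasure_withOrientation, ← facetMeasure_withOrientation χ l, h]

end FacetMeasure

/-! ### Almost surely no hyperplane is repeated. -/

section Hyperplanes

variable {d : ℕ} {b : ℝ} {χ : Window d b → ℝ≥0} {a : ℝ≥0∞}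
  {Q : Measure (Configuration (Facet d b))}

/-- Cut `[0,b]` into `n + 1` intervals for each orientation. Two facets in one hyperplane lie in a
common strip, which has probability `O(1/(n+1)²)`; summing over strips leaves `O(1/(n+1))`. -/
lemma ae_not_sameHyperplane (hb : 0 < b) (hχ : ∃ M : ℝ≥0, ∀ z, χ z ≤ M) (ha : a ≠ ∞)
    (hQ : IsPoissonProcess Q (a • facetMeasure χ) id) :
    ∀ᵐ x ∂Q, ∀ y ∈ x, ∀ y' ∈ x, y ≠ y' → ¬ Facet.SameHyperplane y y' := by
  classical
  obtain ⟨C, hC⟩ := exists_facetMeasure_strip_le hχ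
  lift a to ℝ≥0 using ha
  let I : ℕ → ℕ → Set ℝ := fun n j => Set.Icc (j * (b / (n + 1))) ((j + 1) * (b / (n + 1)))
  rw [ae_iff]
  set B : Set (Configuration (Facet d b)) :=
    {x | ¬ ∀ y ∈ x, ∀ y' ∈ x, y ≠ y' → ¬ Facet.SameHyperplane y y'}
  have hsub : ∀ n : ℕ, B ⊆ ⋃ l : Fin d, ⋃ j : Fin (n + 1),
      {x | 2 ≤ Configuration.count (Facet.strip l (I n j)) x} := by
    intro n x hx
    simp only [B, Set.mem_ofPred_eq, not_forall, not_not] at hx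
    obtain ⟨y, hy, y', hy', hne, ho, hcen⟩ := hx
    set l := Facet.orientation y
    have hy0 := Facet.centre_mem y l
    have hn : (0 : ℝ) < n + 1 := by positivity
    have hδ : 0 < b / (n + 1) := by positivity
    have hj : ∃ j : Fin (n + 1), Facet.centre y l ∈ I n j := by
      set t := Facet.centre y l
      have ht : t / (b / (n + 1)) ≤ n + 1 := by
        rw [div_le_iff₀ hδ]
        have : (n + 1) * (b / (n + 1)) = b := by field_simp
        rw [this]
        exact hy0.2
      have ht0 : 0 ≤ t / (b / (n + 1)) := div_nonneg hy0.1 hδ.le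
      rcases lt_or_ge (t / (b / (n + 1))) (n + 1) with hlt | hge
      · refine ⟨⟨⌊t / (b / (n + 1))⌋₊, ?_⟩, ?_, ?_⟩
        · rw [Nat.floor_lt ht0]
          exact_mod_cast hlt
        · exact (le_div_iff₀ hδ).1 (Nat.floor_le ht0)
        · exact (div_le_iff₀ hδ).1 (Nat.lt_floor_add_one _).le
      -- The right endpoint `b` has floor index `n + 1`, so it is put in the last closed interval.
      · refine ⟨Fin.last n, ?_, ?_⟩
        · rw [Fin.val_last]
          exact (le_div_iff₀ hδ).1 (by linarith)
        · rw [Fin.val_last]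
          exact (div_le_iff₀ hδ).1 ht
    obtain ⟨j, hj⟩ := hj
    refine Set.mem_iUnion.2 ⟨l, Set.mem_iUnion.2 ⟨j, ?_⟩⟩
    have h2 : ({y, y'} : Finset (Facet d b)).card = 2 := Finset.card_pair hne
    change 2 ≤ (x.filter fun y => y ∈ Facet.strip l (I n j)).card
    rw [← h2]
    refine Finset.card_le_card fun z hz => ?_
    rw [Finset.mem_insert, Finset.mem_singleton] at hz
    rcases hz with rfl | rfl
    · exact Finset.mem_filter.2 ⟨hy, rfl, hj⟩
    · exact Finset.mem_filter.2 ⟨hy', ho.symm, hcen ▸ hj⟩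
  have hle : ∀ n : ℕ, Q B ≤ ENNReal.ofReal (d * (a * C * b) ^ 2 * (1 / ((n : ℝ) + 1))) := by
    intro n
    have hn : (0 : ℝ) < n + 1 := by positivity
    have hbn : 0 ≤ b / (n + 1) := by positivity
    have hs : ∀ (l : Fin d) (j : Fin (n + 1)),
        Q {x | 2 ≤ Configuration.count (Facet.strip l (I n j)) x} ≤
          ENNReal.ofReal ((a * C * (b / (n + 1))) ^ 2) := by
      intro l j
      refine (hQ.measure_two_le_count (Facet.measurableSet_strip l measurableSet_Icc)).trans ?_
      rw [ENNReal.ofReal_pow (by positivity)]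
      gcongr
      rw [Measure.smul_apply, smul_eq_mul, mul_assoc, ENNReal.ofReal_mul a.coe_nonneg,
        ENNReal.ofReal_coe_nnreal, ENNReal.ofReal_mul C.coe_nonneg, ENNReal.ofReal_coe_nnreal]
      gcongr
      refine (hC l _ measurableSet_Icc).trans (le_of_eq ?_)
      rw [Real.volume_Icc]
      congr 2
      ring
    calc Q B ≤ ∑ l : Fin d, ∑ j : Fin (n + 1),
          Q {x | 2 ≤ Configuration.count (Facet.strip l (I n j)) x} := by
          refine (measure_mono (hsub n)).trans ?_
          refine (measure_iUnion_fintype_le _ _).trans (Finset.sum_le_sum fun l _ => ?_)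
          exact measure_iUnion_fintype_le _ _
      _ ≤ ∑ l : Fin d, ∑ j : Fin (n + 1), ENNReal.ofReal ((a * C * (b / (n + 1))) ^ 2) :=
          Finset.sum_le_sum fun l _ => Finset.sum_le_sum fun j _ => hs l j
      _ = ENNReal.ofReal (d * (a * C * b) ^ 2 * (1 / ((n : ℝ) + 1))) := by
          rw [Finset.sum_const, Finset.sum_const, Finset.card_univ, Finset.card_univ,
            Fintype.card_fin, Fintype.card_fin, nsmul_eq_mul, nsmul_eq_mul,
            ← ENNReal.ofReal_natCast, ← ENNReal.ofReal_natCast,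
            ← ENNReal.ofReal_mul (by positivity), ← ENNReal.ofReal_mul (by positivity)]
          congr 1
          push_cast
          field_simp
  have hlim : Filter.Tendsto
      (fun n : ℕ => ENNReal.ofReal (d * (a * C * b) ^ 2 * (1 / ((n : ℝ) + 1))))
      Filter.atTop (nhds 0) := by
    have h := (tendsto_one_div_add_atTop_nhds_zero_nat (𝕜 := ℝ)).const_mul
      ((d : ℝ) * (a * C * b) ^ 2)
    rw [mul_zero] at h
    simpa using ENNReal.tendsto_ofReal h
  exact nonpos_iff_eq_zero.1 (ge_of_tendsto' hlim hle)

lemma ae_forall_not_sameHyperplane (hχ : ∃ M : ℝ≥0, ∀ z, χ z ≤ M)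
    (hQ : IsPoissonProcess Q (a • facetMeasure χ) id) (u : Facet d b) :
    ∀ᵐ x ∂Q, ∀ y ∈ x, ¬ Facet.SameHyperplane u y := by
  obtain ⟨C, hC⟩ := exists_facetMeasure_strip_le hχ
  set I : Set ℝ := {Facet.centre u (Facet.orientation u)}
  set B : Set (Facet d b) := Facet.strip (Facet.orientation u) I
  have h0 : (a • facetMeasure χ) B = 0 := by
    have h1 := hC (Facet.orientation u) I (measurableSet_singleton _)
    rw [Real.volume_singleton, mul_zero] at h1
    rw [Measure.smul_apply, nonpos_iff_eq_zero.1 h1, smul_zero]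
  have h2 := hQ.measure_count_ne_zero (Facet.measurableSet_strip _ (measurableSet_singleton _)) h0
  filter_upwards [show ∀ᵐ x ∂Q, Configuration.count B x = 0 from ae_iff.2 h2] with x hx y hy hs
  exact Configuration.count_eq_zero.1 hx y hy ⟨hs.1.symm, hs.2.symm⟩

end Hyperplanes

/-! ### Expectations of the pointwise bounds. -/

section Integrals

variable {d c : ℕ} {b m : ℝ} {Q : Measure (Configuration (Facet d b))}
  {Λ : Measure (Facet d b)}

lemma integrable_powCount [IsProbabilityMeasure Q] (A : Finset (Fin d)) {r : ℝ} (h0 : 0 ≤ r)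
    (h1 : r ≤ 1) : Integrable (powCount (b := b) A r) Q :=
  IsPoissonProcess.integrable_prod_pow_count Facet.measurableSet_withOrientation
    (fun j => by split_ifs <;> simp [h0]) (fun j => by split_ifs <;> simp [h1])

lemma integral_powCount (hQ : IsPoissonProcess Q Λ id)
    (hm : ∀ l, (Λ (Facet.withOrientation l)).toReal = m) (A : Finset (Fin d)) (r : ℝ) :
    ∫ x, powCount A r x ∂Q = Real.exp (-(m * Aᶜ.card * (1 - r))) := by
  refine (hQ.integral_prod_pow_count Facet.measurableSet_withOrientation ?_ _).trans ?_
  · intro i j hij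
    exact Set.disjoint_left.2 fun y hi hj => hij (hi.symm.trans hj)
  · congr 2
    rw [← Finset.sum_add_sum_compl A, Finset.sum_eq_zero, zero_add,
      Finset.sum_congr rfl (g := fun _ => m * (1 - r)), Finset.sum_const, nsmul_eq_mul]
    · ring
    · intro j hj
      rw [hm, if_neg (Finset.mem_compl.1 hj)]
    · intro j hj
      rw [if_pos hj, sub_self, mul_zero]

/-- Complementation turns these sets into the subsets of `Kᶜ` of size `d - c + 1`. If `K` has at
least `c` elements, both sides vanish. -/
lemma card_filter_superset (hc : 1 ≤ c) (hcd : c ≤ d) (K : Finset (Fin d)) :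
    (((Finset.univ : Finset (Fin d)).powersetCard (c - 1)).filter (K ⊆ ·)).card =
      (d - K.card).choose (d - c + 1) := by
  have h : (d - K.card).choose (d - c + 1) = (Kᶜ.powersetCard (d - c + 1)).card := by
    rw [Finset.card_powersetCard, Finset.card_compl, Fintype.card_fin]
  rw [h]
  refine Finset.card_bij' (fun A _ => Aᶜ) (fun A _ => Aᶜ) ?_ ?_ ?_ ?_
  · intro A hA
    obtain ⟨h1, h2⟩ := Finset.mem_filter.1 hA
    refine Finset.mem_powersetCard.2 ⟨Finset.compl_subset_compl.2 h2, ?_⟩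
    rw [Finset.card_compl, (Finset.mem_powersetCard.1 h1).2, Fintype.card_fin]
    omega
  · intro A hA
    obtain ⟨h1, h2⟩ := Finset.mem_powersetCard.1 hA
    refine Finset.mem_filter.2 ⟨Finset.mem_powersetCard.2 ⟨Finset.subset_univ _, ?_⟩, ?_⟩
    · rw [Finset.card_compl, h2, Fintype.card_fin]
      omega
    · exact Finset.subset_compl_comm.1 h1
  · intro A _
    exact compl_compl A
  · intro A _
    exact compl_compl A

lemma measurableSet_fewOrientations (K : Finset (Fin d)) :
    MeasurableSet (fewOrientations d c b K) :=
  MeasurableSet.biUnion (Set.to_countable _) fun A _ =>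
    Configuration.measurable_count (Facet.measurableSet_orientation_notMem A)
      (measurableSet_singleton 0)

lemma le_measureReal_fewOrientations (hc : 1 ≤ c) (hcd : c ≤ d) (hQ : IsPoissonProcess Q Λ id)
    [IsProbabilityMeasure Q] (hm : ∀ l, (Λ (Facet.withOrientation l)).toReal = m)
    (K : Finset (Fin d)) :
    ((d - K.card).choose (d - c + 1) : ℝ) *
      (Real.exp (-(m * (d - c + 1 : ℕ))) - c * Real.exp (-(m * (d - c + 1 + 1 : ℕ)))) ≤
      Q.real (fewOrientations d c b K) := by
  have hi : ∀ A : Finset (Fin d), Integrable (powCount (b := b) A 0) Q := fun A =>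
    integrable_powCount A le_rfl zero_le_one
  have hd : ∀ A : Finset (Fin d),
      Integrable (fun x => powCount (b := b) A 0 x - ∑ i ∈ A, powCount (A.erase i) 0 x) Q :=
    fun A => (hi A).sub (integrable_finsetSum _ fun i _ => hi _)
  have h1 : ∫ x, ∑ A ∈ (Finset.univ.powersetCard (c - 1)).filter (K ⊆ ·),
      (powCount A 0 x - ∑ i ∈ A, powCount (A.erase i) 0 x) ∂Q ≤
      ∫ x, (fewOrientations d c b K).indicator 1 x ∂Q := by
    refine integral_mono ?_ ?_ (sum_powCount_le_indicator K)
    · exact integrable_finsetSum _ fun A _ => hd A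
    · exact (integrable_const (1 : ℝ)).indicator (measurableSet_fewOrientations K)
  rw [integral_indicator_one (measurableSet_fewOrientations K)] at h1
  refine le_trans ?_ h1
  rw [integral_finsetSum _ fun A _ => hd A,
    ← card_filter_superset hc hcd K, ← nsmul_eq_mul]
  refine Finset.card_nsmul_le_sum _ _ _ fun A hA => ?_
  have hAc := (Finset.mem_powersetCard.1 (Finset.mem_filter.1 hA).1).2
  rw [integral_sub (hi A) (integrable_finsetSum _ fun i _ => hi _),
    integral_finsetSum _ fun i _ => hi _, integral_powCount hQ hm,
    Finset.sum_congr rfl (g := fun _ => Real.exp (-(m * (d - c + 1 + 1 : ℕ)))),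
    Finset.sum_const, nsmul_eq_mul, hAc, Finset.card_compl, hAc, Fintype.card_fin,
    show d - (c - 1) = d - c + 1 by omega, sub_zero, mul_one]
  · gcongr
    omega
  · intro i hi
    rw [integral_powCount hQ hm, Finset.card_compl, Finset.card_erase_of_mem hi, hAc,
      Fintype.card_fin, sub_zero, mul_one, show d - (c - 1 - 1) = d - c + 1 + 1 by
        have := Finset.card_pos.2 ⟨i, hi⟩
        omega]

/-- A single `A` already gives this. Unlike the sharper bound above, it stays positive for small
`m`, which keeps the normalizing constant away from zero uniformly in `a`. -/
lemma exp_le_measureReal_fewOrientations (hc : 1 ≤ c) (hcd : c ≤ d)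
    (hQ : IsPoissonProcess Q Λ id) [IsProbabilityMeasure Q]
    (hm : ∀ l, (Λ (Facet.withOrientation l)).toReal = m) :
    Real.exp (-(m * (d - c + 1 : ℕ))) ≤ Q.real (fewOrientations d c b ∅) := by
  obtain ⟨A, -, hA⟩ := Finset.exists_subset_card_eq
    (show c - 1 ≤ (Finset.univ : Finset (Fin d)).card by simp; omega)
  have h := integral_powCount hQ hm A 0
  rw [Finset.card_compl, hA, Fintype.card_fin, sub_zero, mul_one,
    show d - (c - 1) = d - c + 1 by omega] at h
  rw [← h, ← integral_indicator_one (measurableSet_fewOrientations ∅)]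
  refine integral_mono (integrable_powCount A le_rfl zero_le_one)
    ((integrable_const (1 : ℝ)).indicator (measurableSet_fewOrientations ∅)) fun x => ?_
  by_cases hx : Configuration.count {y | Facet.orientation y ∉ A} x = 0
  · rw [powCount_eq, hx, pow_zero, Set.indicator_of_mem]
    · simp
    · exact Set.mem_biUnion (x := A) ⟨hA, Finset.empty_subset _⟩ hx
  · rw [powCount_eq, zero_pow hx]
    exact Set.indicator_nonneg (fun _ _ => zero_le_one) _

lemma integrable_weightBound [IsProbabilityMeasure Q] {κ τ T : ℝ} (hκT : 0 ≤ κ * T)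
    (hτ : 0 ≤ τ) (K : Finset (Fin d)) : Integrable (weightBound (b := b) d c κ τ T K) Q := by
  refine Integrable.add (integrable_finsetSum _ fun D _ => Integrable.const_mul ?_ _)
    (integrable_finsetSum _ fun A _ => Integrable.const_mul ?_ _)
  · exact integrable_powCount _ (Real.exp_pos _).le (Real.exp_le_one_iff.2 (by linarith))
  · exact integrable_powCount _ (Real.exp_pos _).le (Real.exp_le_one_iff.2 (by linarith))

lemma integral_weightBound_le (hc : 2 ≤ c) (hcd : c ≤ d) (hQ : IsPoissonProcess Q Λ id)
    [IsProbabilityMeasure Q] (hm : ∀ l, (Λ (Facet.withOrientation l)).toReal = m)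
    {κ τ T : ℝ} (hκT : 0 ≤ κ * T) (hτ : 0 ≤ τ) (K : Finset (Fin d)) :
    ∫ x, weightBound d c κ τ T K x ∂Q ≤
      d.choose (c - 2) * (Real.exp (τ * T) ^ (d - c + 1 + 1) *
        Real.exp (-(m * (d - c + 1 + 1 : ℕ) * (1 - Real.exp (-τ))))) +
      (((d - K.card).choose (d - c + 1) : ℝ) + d.choose (d - c + 1) * Real.exp (-(κ * T))) *
        Real.exp (-(m * (d - c + 1 : ℕ) * (1 - Real.exp (-(κ * T))))) := by
  classical
  have h1 : ∀ D : Finset (Fin d), Integrable (powCount (b := b) D (Real.exp (-τ))) Q := fun D =>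
    integrable_powCount _ (Real.exp_pos _).le (Real.exp_le_one_iff.2 (by linarith))
  have h2 : ∀ D : Finset (Fin d), Integrable (powCount (b := b) D (Real.exp (-(κ * T)))) Q :=
    fun D => integrable_powCount _ (Real.exp_pos _).le (Real.exp_le_one_iff.2 (by linarith))
  unfold weightBound
  rw [integral_add (integrable_finsetSum _ fun D _ => (h1 D).const_mul _)
    (integrable_finsetSum _ fun A _ => (h2 A).const_mul _),
    integral_finsetSum _ fun D _ => (h1 D).const_mul _,
    integral_finsetSum _ fun A _ => (h2 A).const_mul _]
  simp_rw [integral_const_mul, integral_powCount hQ hm]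
  refine add_le_add (le_of_eq ?_) ?_
  · rw [Finset.sum_congr rfl (g := fun _ => Real.exp (τ * T) ^ (d - c + 1 + 1) *
        Real.exp (-(m * (d - c + 1 + 1 : ℕ) * (1 - Real.exp (-τ)))))]
    · rw [Finset.sum_const, nsmul_eq_mul, Finset.card_powersetCard, Finset.card_univ,
        Fintype.card_fin]
    · intro D hD
      rw [Finset.card_compl, (Finset.mem_powersetCard.1 hD).2, Fintype.card_fin,
        show d - (c - 2) = d - c + 1 + 1 by omega]
  · rw [Finset.sum_congr rfl (g := fun A => (if K ⊆ A then 1 else Real.exp (-(κ * T))) *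
        Real.exp (-(m * (d - c + 1 : ℕ) * (1 - Real.exp (-(κ * T)))))), ← Finset.sum_mul]
    · gcongr
      rw [← card_filter_superset (by omega) hcd K]
      have h3 := card_filter_superset (d := d) (by omega) hcd ∅
      simp only [Finset.empty_subset, Finset.filter_true, Finset.card_empty, Nat.sub_zero] at h3
      rw [← h3, ← nsmul_eq_mul, ← Finset.sum_const, Finset.natCast_card_filter,
        ← Finset.sum_add_distrib]
      refine Finset.sum_le_sum fun A _ => ?_
      have := Real.exp_pos (-(κ * T))
      split_ifs <;> linarith
    · intro A hA
      rw [Finset.card_compl, (Finset.mem_powersetCard.1 hA).2, Fintype.card_fin,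
        show d - (c - 1) = d - c + 1 by omega]

end Integrals

/-! ### An elementary exponential estimate. -/

section RealBounds

/-- Half of the decay `e^{-σm}` absorbs the factor `m`, since `m e^{-σm/2} ≤ 2/σ`; then `e^t ≤ 1 + t
e^t`. -/
lemma exp_mul_exp_neg_le {n σ m : ℝ} (hn : 0 ≤ n) (hσ : 0 < σ) (hm : 0 ≤ m) :
    Real.exp (m * n * Real.exp (-(σ * m))) ≤
      1 + 2 * n / σ * Real.exp (2 * n / σ) * Real.exp (-(σ / 2 * m)) := by
  set t := m * n * Real.exp (-(σ * m)) with ht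
  set e := Real.exp (-(σ / 2 * m)) with he
  have he1 : e ≤ 1 := Real.exp_le_one_iff.2 (by have := mul_nonneg hσ.le hm; linarith)
  have he0 : 0 < e := Real.exp_pos _
  have hee : Real.exp (-(σ * m)) = e * e := by
    rw [he, ← Real.exp_add]
    congr 1
    ring
  have hme : m * e ≤ 2 / σ := by
    have h1 : σ / 2 * m ≤ Real.exp (σ / 2 * m) := by
      linarith [Real.add_one_le_exp (σ / 2 * m)]
    have h2 : σ / 2 * m * e ≤ 1 := by
      calc σ / 2 * m * e ≤ Real.exp (σ / 2 * m) * e := by gcongr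
        _ = 1 := by rw [he, ← Real.exp_add, add_neg_cancel, Real.exp_zero]
    rw [le_div_iff₀ hσ]
    linarith
  have ht1 : t ≤ 2 * n / σ * e := by
    calc t = n * (m * e) * e := by rw [ht, hee]; ring
      _ ≤ n * (2 / σ) * e := by gcongr
      _ = 2 * n / σ * e := by ring
  have hc0 : 0 ≤ 2 * n / σ := by positivity
  have ht2 : t ≤ 2 * n / σ := ht1.trans (mul_le_of_le_one_right hc0 he1)
  have h3 : Real.exp t ≤ 1 + t * Real.exp t := by
    have h4 := Real.add_one_le_exp (-t)
    have h5 : Real.exp (-t) * Real.exp t = 1 := by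
      rw [← Real.exp_add, neg_add_cancel, Real.exp_zero]
    nlinarith [Real.exp_pos t]
  have ht0 : 0 ≤ t := by positivity
  calc Real.exp t ≤ 1 + t * Real.exp t := h3
    _ ≤ 1 + 2 * n / σ * e * Real.exp (2 * n / σ) := by gcongr
    _ = _ := by ring

end RealBounds

/-! ### Two-sided bounds relative to `e^{-mn}`, with constants independent of the intensity. -/

section NormalizedBounds

open Classical in
lemma exists_normalized_bounds {d c : ℕ} (hc : 2 ≤ c) (hcd : c ≤ d) {b : ℝ} (hb : 0 < b)
    {ν : ℝ} (hν : ν < 0) :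
    ∃ R S : ℝ, 0 < R ∧ 0 < S ∧ ∀ {Q : Measure (Configuration (Facet d b))}
      {Λ : Measure (Facet d b)} [IsProbabilityMeasure Q] {m : ℝ}, 0 < m →
      IsPoissonProcess Q Λ id → (∀ l, (Λ (Facet.withOrientation l)).toReal = m) →
      ∀ {p : ℕ} (u : Fin p → Facet d b),
        ∫⁻ x, submodelWeight c ν (x ∪ Finset.univ.image u) ∂Q ≤
          ENNReal.ofReal (Real.exp (-(m * (d - c + 1 : ℕ))) *
            ((d - (orientations u).card).choose (d - c + 1) + R * Real.exp (-(S * m)))) ∧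
        Real.exp (-(m * (d - c + 1 : ℕ))) *
            ((d - (orientations u).card).choose (d - c + 1) - R * Real.exp (-(S * m))) ≤
          Q.real (fewOrientations d c b (orientations u)) := by
  obtain ⟨κ, hκ, hw⟩ := exists_submodelWeight_le_weightBound hc hcd hb hν
  set n := d - c + 1 with hn
  -- With `e^{-τ} = 1/(4(n+1))` and `ε τ = 1/(4(n+1))`, the Chernoff term loses `m/4` twice from the
  -- exponent `m(n+1)`, leaving exactly `e^{-mn} e^{-m/2}`.
  set τ := Real.log (4 * (n + 1)) with hτ
  have hτ0 : 0 < τ := Real.log_pos (by have : (0 : ℝ) ≤ n := by positivity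
                                       linarith)
  have hτe : Real.exp (-τ) = 1 / (4 * (n + 1)) := by
    rw [Real.exp_neg, hτ, Real.exp_log (by positivity), one_div]
  set ε := 1 / (4 * (n + 1) * τ) with hε
  have hε0 : 0 < ε := by positivity
  set σ := κ * ε with hσ
  have hσ0 : 0 < σ := by positivity
  set R₁ := 2 * (n : ℝ) / σ * Real.exp (2 * n / σ) with hR₁
  have hR₁0 : 0 ≤ R₁ := by positivity
  set C₁ : ℝ := (d.choose n : ℝ) with hC₁
  set C₂ : ℝ := (d.choose (c - 2) : ℝ) with hC₂
  have hC₁0 : 0 ≤ C₁ := by positivity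
  have hC₂0 : 0 ≤ C₂ := by positivity
  refine ⟨C₂ + C₁ * R₁ + C₁ * (1 + R₁) + C₁ * c + 1, min (1 / 2) (σ / 2), by positivity,
    by positivity, ?_⟩
  intro Q Λ _ m hm0 hQ hm p u
  set E := Real.exp (-(min (1 / 2) (σ / 2) * m)) with hE
  have hE0 : 0 < E := Real.exp_pos _
  have hE1 : Real.exp (-(m / 2)) ≤ E := Real.exp_le_exp.2 (by
    have := mul_le_mul_of_nonneg_right (min_le_left (1 / 2) (σ / 2)) hm0.le
    linarith)
  have hE2 : Real.exp (-(σ / 2 * m)) ≤ E := Real.exp_le_exp.2 (by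
    have := mul_le_mul_of_nonneg_right (min_le_right (1 / 2) (σ / 2)) hm0.le
    linarith)
  set K := orientations u
  set N : ℝ := ((d - K.card).choose n : ℝ) with hN
  have hN0 : 0 ≤ N := by positivity
  have hNC : N ≤ C₁ := by
    rw [hN, hC₁]
    exact_mod_cast Nat.choose_le_choose n (Nat.sub_le d K.card)
  set w := Real.exp (-(m * (n : ℕ))) with hwdef
  have hw0 : 0 < w := Real.exp_pos _
  constructor
  · have hT : 0 < ε * m := by positivity
    have hi : Integrable (weightBound (b := b) d c κ τ (ε * m) K) Q :=
      integrable_weightBound (by positivity) hτ0.le K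
    have hpos : ∀ x, 0 ≤ weightBound (b := b) d c κ τ (ε * m) K x := fun x =>
      add_nonneg
        (Finset.sum_nonneg fun D _ => mul_nonneg (by positivity)
          (powCount_nonneg _ (Real.exp_pos _).le _))
        (Finset.sum_nonneg fun A _ => mul_nonneg (by split_ifs <;> positivity)
          (powCount_nonneg _ (Real.exp_pos _).le _))
    refine (lintegral_mono fun x => hw u τ (ε * m) hτ0.le hT x).trans ?_
    rw [← ofReal_integral_eq_lintegral_ofReal hi (ae_of_all _ hpos)]
    refine ENNReal.ofReal_le_ofReal ?_
    refine (integral_weightBound_le hc hcd hQ hm (by positivity) hτ0.le K).trans ?_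
    have hA : Real.exp (τ * (ε * m)) ^ (n + 1) *
        Real.exp (-(m * (n + 1 : ℕ) * (1 - Real.exp (-τ)))) = w * Real.exp (-(m / 2)) := by
      rw [← Real.exp_nat_mul, ← Real.exp_add, hwdef, ← Real.exp_add, hτe, hε]
      congr 1
      push_cast
      field_simp
      ring
    have hq : Real.exp (-(κ * (ε * m))) = Real.exp (-(σ * m)) := by
      rw [hσ, mul_assoc]
    have hqE : Real.exp (-(σ * m)) ≤ E := by
      refine le_trans (Real.exp_le_exp.2 ?_) hE2
      have : 0 ≤ σ * m := by positivity
      linarith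
    have hqE1 : E ≤ 1 := Real.exp_le_one_iff.2 (by
      have : 0 ≤ min (1 / 2) (σ / 2) * m := by positivity
      linarith)
    have hB : Real.exp (-(m * n * (1 - Real.exp (-(σ * m))))) ≤ w * (1 + R₁ * E) := by
      have h1 := exp_mul_exp_neg_le (n := n) (by positivity) hσ0 hm0.le
      calc Real.exp (-(m * n * (1 - Real.exp (-(σ * m)))))
          = w * Real.exp (m * n * Real.exp (-(σ * m))) := by
            rw [hwdef, ← Real.exp_add]
            congr 1
            ring
        _ ≤ w * (1 + R₁ * Real.exp (-(σ / 2 * m))) := by gcongr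
        _ ≤ w * (1 + R₁ * E) := by gcongr
    rw [hA, hq]
    calc C₂ * (w * Real.exp (-(m / 2))) + (N + C₁ * Real.exp (-(σ * m))) *
          Real.exp (-(m * n * (1 - Real.exp (-(σ * m)))))
        ≤ C₂ * (w * E) + (N + C₁ * E) * (w * (1 + R₁ * E)) := by gcongr
      _ = w * (N + (C₂ + N * R₁ + C₁ * (1 + R₁ * E)) * E) := by ring
      _ ≤ w * (N + (C₂ + C₁ * R₁ + C₁ * (1 + R₁ * 1)) * E) := by gcongr
      _ ≤ w * (N + (C₂ + C₁ * R₁ + C₁ * (1 + R₁) + C₁ * c + 1) * E) := by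
        have h0 : 0 ≤ C₁ * c := by positivity
        have h1 : C₂ + C₁ * R₁ + C₁ * (1 + R₁ * 1) ≤
            C₂ + C₁ * R₁ + C₁ * (1 + R₁) + C₁ * c + 1 := by linarith
        exact mul_le_mul_of_nonneg_left
          (add_le_add_right (mul_le_mul_of_nonneg_right h1 hE0.le) N) hw0.le
  · refine le_trans ?_ (le_measureReal_fewOrientations (by omega) hcd hQ hm K)
    have h1 : Real.exp (-(m * (n + 1 : ℕ))) ≤ w * E := by
      refine le_trans (le_of_eq ?_) (mul_le_mul_of_nonneg_left
        ((Real.exp_le_exp.2 (show -m ≤ -(m / 2) by linarith)).trans hE1) hw0.le)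
      rw [hwdef, ← Real.exp_add]
      congr 1
      push_cast
      ring
    have h2 : N * (w - c * (w * E)) ≤ N * (w - c * Real.exp (-(m * (n + 1 : ℕ)))) := by gcongr
    refine le_trans ?_ h2
    have h3 : N * c ≤ C₂ + C₁ * R₁ + C₁ * (1 + R₁) + C₁ * c + 1 := by
      have : N * c ≤ C₁ * c := by gcongr
      have : 0 ≤ C₁ * R₁ := by positivity
      have : 0 ≤ C₁ * (1 + R₁) := by positivity
      linarith
    have h4 : N * c * E * w ≤ (C₂ + C₁ * R₁ + C₁ * (1 + R₁) + C₁ * c + 1) * E * w := by gcongr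
    linarith

end NormalizedBounds

/-! ### The correlation function as a quotient of expected weights. -/

section Correlation

variable {d c : ℕ} {b ν : ℝ} {Q : Measure (Configuration (Facet d b))}

open Classical in
-- The density cancels against the denominator of the conditional intensity. Passing to a measurable
-- minorant of the density with the same `withDensity` measure avoids proving that the weight is
-- measurable.
lemma correlation_le [SFinite Q] (h0 : ∫⁻ x, submodelWeight c ν x ∂Q ≠ 0) {p : ℕ}
    (u : Fin p → Facet d b) :
    correlation Q c ν u ≤ (∫⁻ x, submodelWeight c ν x ∂Q)⁻¹ *
      ∫⁻ x, submodelWeight c ν (x ∪ Finset.univ.image u) ∂Q := by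
  obtain ⟨g, hg, hgf, hQg⟩ := exists_measurable_le_withDensity_eq Q (submodelDensity Q c ν)
  rw [correlation, submodelLaw, ← hQg]
  refine (lintegral_withDensity_le_lintegral_mul Q hg _).trans ?_
  rw [← lintegral_const_mul' _ _ (ENNReal.inv_ne_top.2 h0)]
  refine lintegral_mono fun x => ?_
  exact (mul_le_mul_left (hgf x) _).trans ENNReal.mul_div_le

open Classical in
-- On `E` the conditional intensity is 1, so the correlation is at least the mass that the submodel
-- gives to `E`.
lemma le_correlation (h0 : ∫⁻ x, submodelWeight c ν x ∂Q ≠ 0)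
    (h1 : ∫⁻ x, submodelWeight c ν x ∂Q ≠ ∞) {p : ℕ} (u : Fin p → Facet d b)
    {E : Set (Configuration (Facet d b))} (hE : MeasurableSet E)
    (hw : ∀ᵐ x ∂Q, x ∈ E → submodelWeight c ν x = 1 ∧
      submodelWeight c ν (x ∪ Finset.univ.image u) = 1) :
    (∫⁻ x, submodelWeight c ν x ∂Q)⁻¹ * Q E ≤ correlation Q c ν u := by
  have hlaw : submodelLaw Q c ν E = (∫⁻ x, submodelWeight c ν x ∂Q)⁻¹ * Q E := by
    rw [submodelLaw, withDensity_apply _ hE, ← setLIntegral_const]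
    refine setLIntegral_congr_fun_ae hE ?_
    filter_upwards [hw] with x hx hxE
    rw [submodelDensity, (hx hxE).1, mul_one]
  rw [← hlaw, ← setLIntegral_one]
  refine le_trans (le_of_eq ?_) (setLIntegral_le_lintegral E _)
  refine setLIntegral_congr_fun_ae hE ?_
  filter_upwards [(withDensity_absolutelyContinuous Q (submodelDensity Q c ν)).ae_le hw]
    with x hx hxE
  rw [condIntensity, submodelDensity, submodelDensity, (hx hxE).1, (hx hxE).2,
    ENNReal.div_self]
  · simpa using h1
  · simpa using h0

open Classical in
lemma ae_submodelWeight_eq_one {χ : Window d b → ℝ≥0} {a : ℝ≥0∞} (hb : 0 < b) (hc : 1 ≤ c)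
    (hχ : ∃ M : ℝ≥0, ∀ z, χ z ≤ M) (ha : a ≠ ∞)
    (hQ : IsPoissonProcess Q (a • facetMeasure χ) id) {p : ℕ} {u : Fin p → Facet d b}
    (hu : (orientations u).card < c → ∀ i j, i ≠ j → ¬ Facet.SameHyperplane (u i) (u j)) :
    ∀ᵐ x ∂Q, x ∈ fewOrientations d c b (orientations u) → submodelWeight c ν x = 1 ∧
      submodelWeight c ν (x ∪ Finset.univ.image u) = 1 := by
  filter_upwards [ae_not_sameHyperplane hb hχ ha hQ,
    ae_all_iff.2 fun i => ae_forall_not_sameHyperplane hχ hQ (u i)] with x hx hxu hfew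
  obtain ⟨A, ⟨hA, hKA⟩, hxA⟩ := Set.mem_iUnion₂.1 hfew
  have hAc : A.card < c := by omega
  have hu' := hu ((Finset.card_le_card hKA).trans_lt hAc)
  have hxA' : ∀ y ∈ x, Facet.orientation y ∈ A := fun y hy =>
    not_not.1 (Configuration.count_eq_zero.1 hxA y hy)
  refine ⟨submodelWeight_eq_one (facetG_eq_zero hAc hxA' hx),
    submodelWeight_eq_one (facetG_eq_zero hAc ?_ ?_)⟩
  · intro y hy
    rcases Finset.mem_union.1 hy with hy | hy
    · exact hxA' y hy
    · obtain ⟨i, -, rfl⟩ := Finset.mem_image.1 hy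
      exact hKA (Finset.mem_image_of_mem _ (Finset.mem_univ i))
  · intro y hy y' hy' hne hs
    rcases Finset.mem_union.1 hy with hy | hy <;> rcases Finset.mem_union.1 hy' with hy' | hy'
    · exact hx y hy y' hy' hne hs
    · obtain ⟨i, -, rfl⟩ := Finset.mem_image.1 hy'
      exact hxu i y hy ⟨hs.1.symm, by rw [← hs.1]; exact hs.2.symm⟩
    · obtain ⟨i, -, rfl⟩ := Finset.mem_image.1 hy
      exact hxu i y' hy' hs
    · obtain ⟨i, -, rfl⟩ := Finset.mem_image.1 hy
      obtain ⟨j, -, rfl⟩ := Finset.mem_image.1 hy'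
      exact hu' i j (fun h => hne (h ▸ rfl)) hs

/-- Here `z` is the normalizing constant divided by `e^{-mn}`; since `z ≥ 1`, dividing by it does
not enlarge the error. -/
lemma abs_sub_div_le {ρ z N N₀ δ : ℝ} (hz : 1 ≤ z) (hN₀ : 0 < N₀) (hN : 0 ≤ N) (hNN : N ≤ N₀)
    (h1 : |ρ * z - N| ≤ δ) (h2 : |z - N₀| ≤ δ) : |ρ - N / N₀| ≤ 2 * δ := by
  have hr : N / N₀ ≤ 1 := (div_le_one hN₀).2 hNN
  have hr0 : 0 ≤ N / N₀ := by positivity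
  have hδ : 0 ≤ δ := (abs_nonneg _).trans h1
  have h3 : (ρ - N / N₀) * z = (ρ * z - N) - N / N₀ * (z - N₀) := by
    field_simp
    ring
  calc |ρ - N / N₀| ≤ |ρ - N / N₀| * z := le_mul_of_one_le_right (abs_nonneg _) hz
    _ = |(ρ * z - N) - N / N₀ * (z - N₀)| := by
      rw [← h3, abs_mul, abs_of_nonneg (zero_le_one.trans hz)]
    _ ≤ |ρ * z - N| + |N / N₀ * (z - N₀)| := abs_sub _ _
    _ ≤ δ + 1 * δ := by
      rw [abs_mul, abs_of_nonneg hr0]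
      gcongr
    _ = 2 * δ := by ring

end Correlation

theorem lemma1 (d c p : ℕ) (hc : 2 ≤ c) (hcd : c ≤ d) (b : ℝ) (hb : 0 < b)
    (χ : Window d b → ℝ≥0) (hχ : Measurable χ) (hχ_bdd : ∃ M : ℝ≥0, ∀ z, χ z ≤ M)
    (hχ_ne : facetMeasure χ ≠ 0) (ν : ℝ) (hν : ν < 0) :
    ∃ R S : ℝ, 0 < R ∧ 0 < S ∧
      ∀ {Ω : Type*} [MeasurableSpace Ω] (P : Measure Ω) [IsProbabilityMeasure P]
        (a : ℝ) (η : Ω → Configuration (Facet d b)), 0 < a →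
        IsPoissonProcess P (ENNReal.ofReal a • facetMeasure χ) η →
        ∀ x : Fin p → Facet d b, Function.Injective x →
          (numOrientations x < c → ∀ i j, i ≠ j → ¬ Facet.SameHyperplane (x i) (x j)) →
          correlation (P.map η) c ν x ≠ ∞ ∧
          |(correlation (P.map η) c ν x).toReal -
              ((d - numOrientations x).choose (d - c + 1) : ℝ) /
                (d.choose (d - c + 1) : ℝ)| < R * Real.exp (-S * a) := by
  classical
  obtain ⟨R, S, hR, hS, hbound⟩ := exists_normalized_bounds hc hcd hb hν
  obtain ⟨v, hv⟩ : ∃ v : ℝ≥0∞, ∀ l, facetMeasure χ (Facet.withOrientation l) = v :=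
    ⟨_, fun l => facetMeasure_withOrientation χ l⟩
  have l₀ : Fin d := ⟨0, by omega⟩
  have hv0 : 0 < v.toReal := ENNReal.toReal_pos
    (hv l₀ ▸ facetMeasure_withOrientation_ne_zero hχ_ne l₀)
    (hv l₀ ▸ facetMeasure_withOrientation_ne_top hχ_bdd l₀)
  -- The quotient estimate costs a factor 2, the extra 1 makes the inequality strict, and `v`
  -- converts `m = a v` to `a`.
  refine ⟨2 * R + 1, S * v.toReal, by positivity, by positivity, ?_⟩
  intro Ω _ P _ a η ha hη u _ hu
  have hQ := hη.law
  have : IsProbabilityMeasure (P.map η) :=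
    Measure.isProbabilityMeasure_map hη.measurable.aemeasurable
  set Q := P.map η
  have hm0 : 0 < a * v.toReal := by positivity
  have hm : ∀ l, ((ENNReal.ofReal a • facetMeasure χ) (Facet.withOrientation l)).toReal =
      a * v.toReal := fun l => by
    rw [Measure.smul_apply, smul_eq_mul, ENNReal.toReal_mul, ENNReal.toReal_ofReal ha.le, hv l]
  obtain ⟨hU, hL⟩ := hbound hm0 hQ hm u
  -- The empty family of added facets gives the bounds for the normalizing constant.
  obtain ⟨hU₀, hL₀⟩ := hbound hm0 hQ hm (Fin.elim0 : Fin 0 → Facet d b)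
  have hK₀ : orientations (Fin.elim0 : Fin 0 → Facet d b) = ∅ := rfl
  simp only [hK₀, Finset.univ_eq_empty, Finset.image_empty, Finset.union_empty,
    Finset.card_empty, Nat.sub_zero] at hU₀ hL₀
  have hL₁ := exp_le_measureReal_fewOrientations (by omega) hcd hQ hm
  have hae := ae_submodelWeight_eq_one (ν := ν) hb (by omega) hχ_bdd ENNReal.ofReal_ne_top hQ hu
  have hae₀ := ae_submodelWeight_eq_one (c := c) (ν := ν) hb (by omega) hχ_bdd
    ENNReal.ofReal_ne_top hQ (u := (Fin.elim0 : Fin 0 → Facet d b)) fun _ i => i.elim0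
  rw [hK₀] at hae₀
  set w := Real.exp (-(a * v.toReal * (d - c + 1 : ℕ)))
  have hw0 : 0 < w := Real.exp_pos _
  set δ := R * Real.exp (-(S * (a * v.toReal))) with hδ
  set N : ℝ := ((d - (orientations u).card).choose (d - c + 1) : ℝ)
  set N₀ : ℝ := (d.choose (d - c + 1) : ℝ) with hN₀
  set Z := ∫⁻ x, submodelWeight c ν x ∂Q with hZ
  have hZL : Q (fewOrientations d c b ∅) ≤ Z := by
    rw [← setLIntegral_one]
    refine le_trans (le_of_eq ?_) (setLIntegral_le_lintegral (fewOrientations d c b ∅) _)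
    refine setLIntegral_congr_fun_ae (measurableSet_fewOrientations ∅) ?_
    filter_upwards [hae₀] with x hx hxE
    exact (hx hxE).1.symm
  have hZt : Z ≠ ∞ := (hU₀.trans_lt ENNReal.ofReal_lt_top).ne
  have hZL' : Q.real (fewOrientations d c b ∅) ≤ Z.toReal := ENNReal.toReal_mono hZt hZL
  have hZpos : 0 < Z.toReal := hw0.trans_le (hL₁.trans hZL')
  have hZ0 : Z ≠ 0 := fun h => by simp [h] at hZpos
  have hN₀pos : 0 < N₀ := by
    rw [hN₀]
    exact_mod_cast Nat.choose_pos (show d - c + 1 ≤ d by omega)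
  have hN0 : 0 ≤ N := by positivity
  have hNN : N ≤ N₀ := by
    exact Nat.cast_le.2 (Nat.choose_le_choose (d - c + 1) (Nat.sub_le d (orientations u).card))
  have hδ0 : 0 < δ := by positivity
  have hZU : Z.toReal ≤ w * (N₀ + δ) := ENNReal.toReal_le_of_le_ofReal (by positivity) hU₀
  have hcU : correlation Q c ν u ≤ Z⁻¹ * ENNReal.ofReal (w * (N + δ)) :=
    (correlation_le hZ0 u).trans (by gcongr)
  have hcL := le_correlation hZ0 hZt u (measurableSet_fewOrientations _) hae
  have hct : correlation Q c ν u ≠ ∞ :=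
    (hcU.trans_lt (ENNReal.mul_lt_top (ENNReal.inv_lt_top.2 (pos_iff_ne_zero.2 hZ0))
      ENNReal.ofReal_lt_top)).ne
  refine ⟨hct, ?_⟩
  set ρ := (correlation Q c ν u).toReal
  have hρU : ρ * Z.toReal ≤ w * (N + δ) := by
    have h := ENNReal.toReal_mono
      (ENNReal.mul_ne_top (ENNReal.inv_ne_top.2 hZ0) ENNReal.ofReal_ne_top) hcU
    rw [ENNReal.toReal_mul, ENNReal.toReal_inv, ENNReal.toReal_ofReal (by positivity),
      inv_mul_eq_div, le_div_iff₀ hZpos] at h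
    exact h
  have hρL : w * (N - δ) ≤ ρ * Z.toReal := by
    have h := ENNReal.toReal_mono hct hcL
    rw [ENNReal.toReal_mul, ENNReal.toReal_inv, inv_mul_eq_div, div_le_iff₀ hZpos] at h
    exact hL.trans h
  have hz : 1 ≤ Z.toReal / w := (one_le_div hw0).2 (hL₁.trans hZL')
  have h1 : |ρ * (Z.toReal / w) - N| ≤ δ := by
    rw [← mul_div_assoc, abs_le]
    constructor
    · have : N - δ ≤ ρ * Z.toReal / w := (le_div_iff₀ hw0).2 (by linarith)
      linarith
    · have : ρ * Z.toReal / w ≤ N + δ := (div_le_iff₀ hw0).2 (by linarith)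
      linarith
  have h2 : |Z.toReal / w - N₀| ≤ δ := by
    rw [abs_le]
    constructor
    · have : N₀ - δ ≤ Z.toReal / w := (le_div_iff₀ hw0).2 (by linarith [hL₀.trans hZL'])
      linarith
    · have : Z.toReal / w ≤ N₀ + δ := (div_le_iff₀ hw0).2 (by linarith)
      linarith
  refine (abs_sub_div_le hz hN₀pos hN0 hNN h1 h2).trans_lt ?_
  have he : -(S * v.toReal) * a = -(S * (a * v.toReal)) := by ring
  rw [he, hδ]
  linarith [Real.exp_pos (-(S * (a * v.toReal)))]
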